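/- **Model.** In the message-passing model, $k$ players $P_1,\dots,P_k$ with private inputs exchange bits over point-to-point channels: a bit sent from $P_i$ to $P_j$ is seen by $P_i$ and $P_j$ only. The transcript (the sequence of all bits sent so far, with their senders and receivers) determines who speaks next and to whom, or that the communication is over and which player announces the answer. Each bit sent by a player, and the announced answer, depend only on that player's input, random tape, and the bits it has sent and received. (The joint law of the random tapes may be arbitrary, so that both private and shared randomness are covered.) The cost of a protocol is the maximum total number of bits exchanged, over all admissible inputs and all random tapes. For a Boolean function $f$ of the players' inputs, $R^{\delta}(f)$ denotes the minimum cost of a randomized protocol that, on every admissible input, outputs the value of $f$ with error probability at most $\delta$ over the random tapes. **Problem.** In *triangle-freeness with edge duplication*, $P_i$ holds a graph $G_i$ on the vertex set $\{1,\dots,n\}$; an edge may occur in several of the $G_i$. The players must decide whether the union $G=G_1\cup\dots\cup G_k$ contains no triangle. Let $\mathrm{TF}^{=}_{n,m,k}$ be this problem when the admissible inputs are those for which $G$ has exactly $m$ distinct edges, and $\mathrm{TF}^{\le}_{n,m,k}$ when they are those for which $G$ has at most $m$ distinct edges. Logarithms are to base $2$. **Statement.** 1. For every $\gamma$ with $0<\gamma<1/4$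 there are constants $c_k>0$ and $c>0$ (depending only on $\gamma$; the subscript in $c_k$ is only a name) such that for all natural numbers $n,m,k$ with $c_k\log n\le k\le\min\{n,m\}$ and $n\le m\le\gamma n^2$, $$R^{1/3}\bigl(\mathrm{TF}^{=}_{n,m,k}\bigr)\ \ge\ c\,\frac{k\,m}{\log k}.$$ 2. There are absolute constants $c_k>0$ and $c>0$ such that for all natural numbers $n,m,k$ with $c_k\log n\le k\le\min\{n,m\}$ and $n\le m\le\binom n2$, $$R^{1/3}\bigl(\mathrm{TF}^{\le}_{n,m,k}\bigr)\ \ge\ c\,\frac{k\,m}{\log k}.$$ (In the degenerate case $n=m=k=0$ the bound is read as $0$.) -/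

import Mathlib

open scoped ENNReal

namespace MessagePassing

/-- One transmitted bit, together with the channel on which it travels. -/
structure Message (k : ℕ) where
  sender : Fin k
  receiver : Fin k
  bit : Bool

/-- The global transcript: all bits sent so far, the most recent one first. -/
abbrev Transcript (k : ℕ) := List (Message k)

/-- The part of the transcript that player `i` sees: communication is point-to-point, so these
are exactly the bits that `i` sent or received. -/
def Transcript.view {k : ℕ} (i : Fin k) (T : Transcript k) : Transcript k :=
  T.filter fun e => decide (e.sender = i ∨ e.receiver = i)

/-- What happens next: either `i` sends one bit to another player `j`, or the communication is
over and player `i` announces the answer. -/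
inductive Action (k : ℕ) where
  | send (i j : Fin k) (hij : i ≠ j) : Action k
  | halt (i : Fin k) : Action k

/-- A randomized `k`-player protocol with Boolean output in the message-passing model, where
player `i` holds an input from `X i`. The transcript specifies who speaks next, and to whom.
The bit that a player sends, and the answer that it announces, depend only on its own input, its
own random tape and its own view. The joint law of the tapes is arbitrary: independent tapes
(private coins) and identical tapes (public coins) are special cases. -/
structure Protocol (k : ℕ) (X : Fin k → Type) where
  Tape : Fin k → Type
  [tapeSpace : ∀ i, MeasurableSpace (Tape i)]
  law : MeasureTheory.Measure (∀ i, Tape i)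
  [isProb : MeasureTheory.IsProbabilityMeasure law]
  next : Transcript k → Action k
  bit : (i : Fin k) → X i → Tape i → Transcript k → Bool
  answer : (i : Fin k) → X i → Tape i → Transcript k → Bool

namespace Protocol

variable {k : ℕ} {X : Fin k → Type} (P : Protocol k X)

/-- One step of the execution on input `x` with random tapes `ω`. -/
def step (x : ∀ i, X i) (ω : ∀ i, P.Tape i) (T : Transcript k) : Transcript k :=
  match P.next T with
  | .send i j _ => ⟨i, j, P.bit i (x i) (ω i) (T.view i)⟩ :: T
  | .halt _ => T

/-- The transcript after `t` steps. -/
def transcript (x : ∀ i, X i) (ω : ∀ i, P.Tape i) (t : ℕ) : Transcript k :=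
  (P.step x ω)^[t] []

/-- The execution halts and the announced answer is `b`. -/
def Outputs (x : ∀ i, X i) (ω : ∀ i, P.Tape i) (b : Bool) : Prop :=
  ∃ (t : ℕ) (i : Fin k), P.next (P.transcript x ω t) = .halt i ∧
    P.answer i (x i) (ω i) ((P.transcript x ω t).view i) = b

/-- The number of bits exchanged in the execution (`⊤` if it never halts). -/
noncomputable def bits (x : ∀ i, X i) (ω : ∀ i, P.Tape i) : ℕ∞ :=
  ⨆ t : ℕ, ((P.transcript x ω t).length : ℕ∞)

/-- The communication cost: the maximum number of bits over all admissible inputs and all random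
tapes. -/
noncomputable def cost (D : Set (∀ i, X i)) : ℕ∞ :=
  ⨆ x ∈ D, ⨆ ω : ∀ i, P.Tape i, P.bits x ω

/-- On each admissible input, the protocol errs (a wrong answer, or none) with probability at most
`δ` over the random tapes. -/
def Computes (D : Set (∀ i, X i)) (f : (∀ i, X i) → Bool) (δ : ℝ≥0∞) : Prop :=
  letI := P.tapeSpace
  ∀ x ∈ D, P.law {ω | ¬ P.Outputs x ω (f x)} ≤ δ

end Protocol

/-- The randomized `δ`-error communication complexity `R^δ(f)` of `f` with admissible inputs `D`. -/
noncomputable def randomizedCC {k : ℕ} {X : Fin k → Type} (δ : ℝ≥0∞) (D : Set (∀ i, X i))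
    (f : (∀ i, X i) → Bool) : ℕ∞ :=
  ⨅ (P : Protocol k X) (_ : P.Computes D f δ), P.cost D

/-- The input of each site: a graph on the common vertex set `Fin n`. The same edge may be held by
several sites. -/
abbrev SiteGraph (k n : ℕ) : Fin k → Type := fun _ => SimpleGraph (Fin n)

/-- The input graph `G`: the union of the graphs of the sites. -/
def unionGraph {k n : ℕ} (x : ∀ i, SiteGraph k n i) : SimpleGraph (Fin n) := ⨆ i, x i

/-- The number of (distinct) edges of the input graph. -/
noncomputable def numEdges {k n : ℕ} (x : ∀ i, SiteGraph k n i) : ℕ := (unionGraph x).edgeSet.ncard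

open Classical in
/-- Triangle-freeness of the union of the graphs of the sites. -/
noncomputable def triangleFree {k n : ℕ} (x : ∀ i, SiteGraph k n i) : Bool :=
  decide ((unionGraph x).CliqueFree 3)

end MessagePassing

set_option linter.unusedSectionVars false

namespace MessagePassing

/-! ### Information carried by a function of independent coordinates -/

section Information

variable {ι Z 𝒱 : Type*} [Fintype ι] [DecidableEq ι] [Fintype Z] [DecidableEq Z] [DecidableEq 𝒱]

/-! The hard instances hide a two-party problem. One player `j₀`, the centre, holds a label in
`Option Bool` for each slot of a `p × r` grid; every other player holds a set of slots. Slot `(i,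
j)` is the edge between `a i` and `b j`. The centre holds all edges `a i`, `c i`, the slots labelled
`none`, the edges `c i`, `b j` for slots labelled `some true`, and padding. If exactly one player
holds exactly one slot `f` with label other than `none`, every other slot held is a duplicate of a
centre edge. The union is then the centre's graph plus one edge: it has exactly `m` edges, and a
triangle iff the label of `f` is `some true` (`exists_encodesIntersection`). A correct protocol must
therefore find the type of a planted intersection.

This is expensive by an information argument. Take random inputs without intersections, in which
each slot is in one of two random cases: the label is `none`, or the bit is `false`. Given the
cases, bits and labels are independent. What one player sees is a rectangular function of its bits
and the labels, so its law factors, and cut-and-paste of Hellinger distances shows that if it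
reveals little about a slot, planting either type of intersection there hardly changes it
(`sum_intersectExp_sub_le`). So a correct protocol must reveal a constant amount per slot to each
player on average, while the total over the slots is at most the expected code length of the view
(`sum_hellingerSq_pinned_le`), that is, `O(log k)` per bit seen: the logarithm pays for naming
sender and receiver.

Finally, the distribution is the same whichever player is singled out, and each bit lies in only two
views. Summing over the players bounds `k · p · r` by `O(C log k)` up to a lower order term
(`sub_one_mul_card_le`). For `γ < 1/4` the grid can have a constant fraction of `m` slots while the
padding still fits (`exists_sizes`). The problem with at most `m` edges contains the one with
exactly `min m (n ^ 2 / 8)` edges. -/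

/-- The law of `V` when the coordinates of its argument are independent, with weights `w`. -/
noncomputable def productLaw (w : ι → Z → ℝ) (V : (ι → Z) → 𝒱) (v : 𝒱) : ℝ :=
  ∑ z, if V z = v then ∏ g, w g (z g) else 0

/-- The weights `w` with coordinate `f` fixed to the value `s`. -/
noncomputable def pinned (w : ι → Z → ℝ) (f : ι) (s : Z) : ι → Z → ℝ :=
  Function.update w f (Pi.single s 1)

lemma pinned_nonneg {w : ι → Z → ℝ} (hw : ∀ g s, 0 ≤ w g s) (f : ι) (s : Z) (g : ι) (t : Z) :
    0 ≤ pinned w f s g t := by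
  unfold pinned
  by_cases h : g = f
  · subst h
    by_cases h' : t = s
    · subst h'; simp
    · simp [h']
  · simp [h, hw]

lemma sum_pinned {w : ι → Z → ℝ} (hw : ∀ g, ∑ s, w g s = 1) (f : ι) (s : Z) (g : ι) :
    ∑ t, pinned w f s g t = 1 := by
  unfold pinned
  by_cases h : g = f
  · subst h; simp
  · simp [h, hw]

lemma mul_prod_pinned (w : ι → Z → ℝ) (f : ι) (s : Z) (z : ι → Z) :
    w f s * ∏ g, pinned w f s g (z g) = if z f = s then ∏ g, w g (z g) else 0 := by
  rw [← Finset.mul_prod_erase Finset.univ _ (Finset.mem_univ f),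
    ← Finset.mul_prod_erase Finset.univ (fun g => w g (z g)) (Finset.mem_univ f)]
  have h : ∏ g ∈ Finset.univ.erase f, pinned w f s g (z g)
      = ∏ g ∈ Finset.univ.erase f, w g (z g) := by
    refine Finset.prod_congr rfl fun g hg => ?_
    simp [pinned, Finset.ne_of_mem_erase hg]
  rw [h]
  by_cases hs : z f = s
  · simp [pinned, hs]
  · simp [pinned, hs]

lemma productLaw_nonneg {w : ι → Z → ℝ} (hw : ∀ g s, 0 ≤ w g s) (V : (ι → Z) → 𝒱) (v : 𝒱) :
    0 ≤ productLaw w V v :=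
  Finset.sum_nonneg fun z _ => by
    split_ifs
    · exact Finset.prod_nonneg fun g _ => hw g _
    · exact le_rfl

lemma mul_productLaw_pinned (w : ι → Z → ℝ) (V : (ι → Z) → 𝒱) (f : ι) (s : Z) (v : 𝒱) :
    w f s * productLaw (pinned w f s) V v
      = ∑ z, if V z = v then (if z f = s then ∏ g, w g (z g) else 0) else 0 := by
  unfold productLaw
  rw [Finset.mul_sum]
  refine Finset.sum_congr rfl fun z _ => ?_
  rw [← mul_prod_pinned]
  split_ifs <;> simp

lemma sum_mul_productLaw_pinned (w : ι → Z → ℝ) (V : (ι → Z) → 𝒱) (f : ι) (c : Z → ℝ) (v : 𝒱) :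
    ∑ s, c s * (w f s * productLaw (pinned w f s) V v)
      = ∑ z, if V z = v then (∏ g, w g (z g)) * c (z f) else 0 := by
  simp_rw [mul_productLaw_pinned, Finset.mul_sum]
  rw [Finset.sum_comm]
  refine Finset.sum_congr rfl fun z _ => ?_
  by_cases h : V z = v
  · simp [h, mul_comm]
  · simp [h]

lemma sum_fiberwise_law {S : Finset 𝒱} {V : (ι → Z) → 𝒱} (hV : ∀ z, V z ∈ S) (F : (ι → Z) → ℝ) :
    ∑ v ∈ S, ∑ z, (if V z = v then F z else 0) = ∑ z, F z := by
  rw [Finset.sum_comm]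
  refine Finset.sum_congr rfl fun z _ => ?_
  simp [hV z]

lemma sum_prod_eq_one {w : ι → Z → ℝ} (hw : ∀ g, ∑ s, w g s = 1) :
    ∑ z : ι → Z, ∏ g, w g (z g) = 1 := by
  have := Finset.prod_univ_sum (fun _ : ι => (Finset.univ : Finset Z)) w
  simp only [Fintype.piFinset_univ] at this
  rw [← this]
  simp [hw]

lemma sum_productLaw {S : Finset 𝒱} {V : (ι → Z) → 𝒱} (hV : ∀ z, V z ∈ S)
    {w : ι → Z → ℝ} (hw : ∀ g, ∑ s, w g s = 1) :
    ∑ v ∈ S, productLaw w V v = 1 := by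
  unfold productLaw
  rw [sum_fiberwise_law hV, sum_prod_eq_one hw]

/-- The squared Hellinger distance (unnormalized) of two mass functions on `S`. -/
noncomputable def hellingerSq (S : Finset 𝒱) (p p' : 𝒱 → ℝ) : ℝ :=
  ∑ v ∈ S, (√(p v) - √(p' v)) ^ 2

/-- This is `log √t ≥ 1 - 1 / √t` multiplied by `2t`. It bounds squared Hellinger distance by
relative entropy, term by term. -/
lemma sq_sqrt_sub_one_le {t : ℝ} (ht : 0 ≤ t) : (√t - 1) ^ 2 ≤ t * Real.log t - t + 1 := by
  rcases ht.eq_or_lt with rfl | ht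
  · simp
  · have hs : 0 < √t := Real.sqrt_pos.2 ht
    have h1 : 1 - (√t)⁻¹ ≤ Real.log (√t) := Real.one_sub_inv_le_log_of_pos hs
    have h2 : Real.log t = 2 * Real.log (√t) := by
      rw [Real.log_sqrt ht.le]; ring
    have h3 : t = √t * √t := (Real.mul_self_sqrt ht.le).symm
    have h4 : t * (1 - (√t)⁻¹) = t - √t := by
      have h5 : t * (√t)⁻¹ = √t := by
        nth_rewrite 1 [h3]
        rw [mul_assoc, mul_inv_cancel₀ hs.ne', mul_one]
      rw [mul_sub, mul_one, h5]
    have h5 := mul_le_mul_of_nonneg_left h1 ht.le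
    rw [h4] at h5
    rw [h2]
    nlinarith

/-- Each value `v` contributes at most its share of the code length to the total information. -/
lemma information_at_le {w : ι → Z → ℝ} (hw0 : ∀ g s, 0 ≤ w g s) (hw1 : ∀ g, ∑ s, w g s = 1)
    (V : (ι → Z) → 𝒱) (v : 𝒱) {q : ℝ} (hq : 0 < q) :
    ∑ g, ∑ s, w g s * (√(productLaw (pinned w g s) V v) - √(productLaw w V v)) ^ 2
      ≤ q - productLaw w V v + ∑ z, if V z = v then (∏ g, w g (z g)) * -Real.log q else 0 := by
  set p := productLaw w V v with hp
  have hW : ∀ z : ι → Z, 0 ≤ ∏ g, w g (z g) := fun z => Finset.prod_nonneg fun g _ => hw0 g _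
  have hp0 : 0 ≤ p := productLaw_nonneg hw0 V v
  have hP0 : ∀ g s, 0 ≤ productLaw (pinned w g s) V v := fun g s =>
    productLaw_nonneg (pinned_nonneg hw0 g s) V v
  have hmix : ∀ g, ∑ s, w g s * productLaw (pinned w g s) V v = p := by
    intro g
    have := sum_mul_productLaw_pinned w V g (fun _ => 1) v
    simp only [one_mul, mul_one] at this
    exact this
  rcases hp0.eq_or_lt with h0 | hpos
  · rw [← h0]
    have hz : ∀ z, V z = v → ∏ g, w g (z g) = 0 := by
      intro z hz
      have hsum : ∑ z, (if V z = v then ∏ g, w g (z g) else 0) = 0 := h0.symm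
      have := (Finset.sum_eq_zero_iff_of_nonneg (fun z _ => by
        split_ifs
        · exact hW z
        · exact le_rfl)).1 hsum z (Finset.mem_univ _)
      simpa [hz] using this
    have hr : ∑ z, (if V z = v then (∏ g, w g (z g)) * -Real.log q else 0) = 0 :=
      Finset.sum_eq_zero fun z _ => by
        split_ifs with h
        · rw [hz z h]; simp
        · rfl
    have hl : ∑ g, ∑ s, w g s * (√(productLaw (pinned w g s) V v) - √0) ^ 2 = 0 := by
      refine Finset.sum_eq_zero fun g _ => ?_
      simp only [Real.sqrt_zero, sub_zero, Real.sq_sqrt (hP0 g _)]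
      rw [hmix g, ← h0]
    rw [hl, hr]
    linarith
  -- The likelihood ratio: `w g s * φ g s` is the posterior law of coordinate `g` given `V = v`.
  · set φ : ι → Z → ℝ := fun g s => productLaw (pinned w g s) V v / p with hφ
    have hφ0 : ∀ g s, 0 ≤ φ g s := fun g s => div_nonneg (hP0 g s) hp0
    have hφ1 : ∀ g, ∑ s, w g s * φ g s = 1 := by
      intro g
      simp only [hφ, ← mul_div_assoc]
      rw [← Finset.sum_div, hmix, div_self hpos.ne']
    have hg : ∀ g, ∑ s, w g s * (√(productLaw (pinned w g s) V v) - √p) ^ 2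
        ≤ ∑ z, if V z = v then (∏ g, w g (z g)) * Real.log (φ g (z g)) else 0 := by
      intro g
      rw [← sum_mul_productLaw_pinned w V g (fun s => Real.log (φ g s)) v]
      have h1 : ∀ s, w g s * (√(productLaw (pinned w g s) V v) - √p) ^ 2
          ≤ Real.log (φ g s) * (w g s * productLaw (pinned w g s) V v)
            - p * (w g s * φ g s) + p * w g s := by
        intro s
        have e : productLaw (pinned w g s) V v = p * φ g s := by
          simp only [hφ]; field_simp
        rw [e, Real.sqrt_mul hp0]
        have h2 := mul_le_mul_of_nonneg_left (sq_sqrt_sub_one_le (hφ0 g s))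
          (mul_nonneg (hw0 g s) hp0)
        have h3 : (√p) ^ 2 = p := Real.sq_sqrt hp0
        calc w g s * (√p * √(φ g s) - √p) ^ 2
            = w g s * (√p) ^ 2 * (√(φ g s) - 1) ^ 2 := by ring
          _ ≤ _ := by rw [h3]; linarith
      calc _ ≤ _ := Finset.sum_le_sum fun s _ => h1 s
        _ = _ := by
          rw [Finset.sum_add_distrib, Finset.sum_sub_distrib, ← Finset.mul_sum, ← Finset.mul_sum,
            hφ1, hw1]
          ring
    -- On the fibre this is `log (q ∏ φ) ≤ q ∏ φ - 1`; off it, a nonnegative term is added. The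
    -- product of the posteriors then has total mass 1.
    have hz : ∀ z, (if V z = v then (∏ g, w g (z g)) * (∑ g, Real.log (φ g (z g))) else 0)
        ≤ q * (∏ g, w g (z g) * φ g (z g)) - (if V z = v then ∏ g, w g (z g) else 0)
          + (if V z = v then (∏ g, w g (z g)) * -Real.log q else 0) := by
      intro z
      have hR : 0 ≤ q * ∏ g, w g (z g) * φ g (z g) :=
        mul_nonneg hq.le (Finset.prod_nonneg fun g _ => mul_nonneg (hw0 _ _) (hφ0 _ _))
      split_ifs with h
      · rcases (hW z).eq_or_lt with h0 | hzpos
        · rw [← h0]; linarith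
        · have hφpos : ∀ g, 0 < φ g (z g) := by
            intro g
            refine div_pos ?_ hpos
            have h1 : 0 < w g (z g) * productLaw (pinned w g (z g)) V v := by
              rw [mul_productLaw_pinned]
              refine Finset.sum_pos' (fun y _ => ?_) ⟨z, Finset.mem_univ _, ?_⟩
              · split_ifs
                · exact hW y
                · exact le_rfl
                · exact le_rfl
              · simpa [h] using hzpos
            exact pos_of_mul_pos_right h1 (hw0 _ _)
          have hprod : 0 < ∏ g, φ g (z g) := Finset.prod_pos fun g _ => hφpos g
          have hl : Real.log (q * ∏ g, φ g (z g))
              = Real.log q + ∑ g, Real.log (φ g (z g)) := by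
            rw [Real.log_mul hq.ne' hprod.ne', Real.log_prod]
            exact fun g _ => (hφpos g).ne'
          have hle := Real.log_le_sub_one_of_pos (mul_pos hq hprod)
          rw [hl] at hle
          have := mul_le_mul_of_nonneg_left hle hzpos.le
          rw [Finset.prod_mul_distrib]
          linarith
      · linarith
    have hone : ∑ z : ι → Z, ∏ g, w g (z g) * φ g (z g) = 1 :=
      sum_prod_eq_one (w := fun g s => w g s * φ g s) hφ1
    calc ∑ g, ∑ s, w g s * (√(productLaw (pinned w g s) V v) - √p) ^ 2
        ≤ ∑ g, ∑ z, if V z = v then (∏ g, w g (z g)) * Real.log (φ g (z g)) else 0 :=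
          Finset.sum_le_sum fun g _ => hg g
      _ = ∑ z, if V z = v then (∏ g, w g (z g)) * (∑ g, Real.log (φ g (z g))) else 0 := by
          rw [Finset.sum_comm]
          refine Finset.sum_congr rfl fun z _ => ?_
          split_ifs
          · rw [Finset.mul_sum]
          · simp
      _ ≤ _ := Finset.sum_le_sum fun z _ => hz z
      _ = _ := by
          rw [Finset.sum_add_distrib, Finset.sum_sub_distrib, ← Finset.mul_sum, hone, mul_one]
          rfl

/-- Superadditivity of information: the coordinates of a product law are, in total, correlated with
`V` by at most the expected length of any code for `V`. -/
theorem sum_hellingerSq_pinned_le {w : ι → Z → ℝ} (hw0 : ∀ g s, 0 ≤ w g s)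
    (hw1 : ∀ g, ∑ s, w g s = 1) {S : Finset 𝒱} {V : (ι → Z) → 𝒱} (hV : ∀ z, V z ∈ S)
    {q : 𝒱 → ℝ} (hq : ∀ v, 0 < q v) (hqS : ∑ v ∈ S, q v ≤ 1) :
    ∑ g, ∑ s, w g s * hellingerSq S (productLaw (pinned w g s) V) (productLaw w V)
      ≤ ∑ z, (∏ g, w g (z g)) * -Real.log (q (V z)) := by
  calc ∑ g, ∑ s, w g s * hellingerSq S (productLaw (pinned w g s) V) (productLaw w V)
      = ∑ v ∈ S, ∑ g, ∑ s,
          w g s * (√(productLaw (pinned w g s) V v) - √(productLaw w V v)) ^ 2 := by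
        simp only [hellingerSq, Finset.mul_sum]
        rw [Finset.sum_comm]
        conv_rhs => rw [Finset.sum_comm]
        rw [Finset.sum_comm]
        refine Finset.sum_congr rfl fun g _ => ?_
        rw [Finset.sum_comm]
    _ ≤ ∑ v ∈ S, (q v - productLaw w V v
          + ∑ z, if V z = v then (∏ g, w g (z g)) * -Real.log (q v) else 0) :=
        Finset.sum_le_sum fun v _ => information_at_le hw0 hw1 V v (hq v)
    _ = ∑ v ∈ S, q v - 1 + ∑ z, (∏ g, w g (z g)) * -Real.log (q (V z)) := by
        rw [Finset.sum_add_distrib, Finset.sum_sub_distrib, sum_productLaw hV hw1,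
          ← sum_fiberwise_law hV]
        congr 1
        refine Finset.sum_congr rfl fun v _ => Finset.sum_congr rfl fun z _ => ?_
        split_ifs with h
        · rw [h]
        · rfl
    _ ≤ _ := by linarith

lemma hellingerSq_comm (S : Finset 𝒱) (p p' : 𝒱 → ℝ) :
    hellingerSq S p p' = hellingerSq S p' p :=
  Finset.sum_congr rfl fun _ _ => by ring

lemma hellingerSq_nonneg (S : Finset 𝒱) (p p' : 𝒱 → ℝ) : 0 ≤ hellingerSq S p p' :=
  Finset.sum_nonneg fun _ _ => sq_nonneg _

lemma hellingerSq_triangle (S : Finset 𝒱) (p p' p'' : 𝒱 → ℝ) :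
    hellingerSq S p p'' ≤ 2 * hellingerSq S p p' + 2 * hellingerSq S p' p'' := by
  unfold hellingerSq
  rw [Finset.mul_sum, Finset.mul_sum, ← Finset.sum_add_distrib]
  refine Finset.sum_le_sum fun v _ => ?_
  nlinarith [sq_nonneg ((√(p v) - √(p' v)) - (√(p' v) - √(p'' v)))]

/-- Factor a difference as `(√p - √p')(√p + √p')` and use the weighted AM-GM inequality. The bound
is linear in the squared distance, so it can be averaged; two uses lose only `1 / 6`, less than the
required advantage `1 / 3`. -/
lemma sum_abs_sub_le {S : Finset 𝒱} {p p' : 𝒱 → ℝ} (hp : ∀ v, 0 ≤ p v) (hp' : ∀ v, 0 ≤ p' v)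
    (h : ∑ v ∈ S, p v = 1) (h' : ∑ v ∈ S, p' v = 1) :
    ∑ v ∈ S, |p v - p' v| ≤ 12 * hellingerSq S p p' + 1 / 12 := by
  have key : ∀ v, |p v - p' v| ≤ 12 * (√(p v) - √(p' v)) ^ 2 + 1 / 24 * (p v + p' v) := by
    intro v
    have e : p v - p' v = (√(p v) - √(p' v)) * (√(p v) + √(p' v)) := by
      have h1 := Real.mul_self_sqrt (hp v)
      have h2 := Real.mul_self_sqrt (hp' v)
      nlinarith
    have h1 := Real.sq_sqrt (hp v)
    have h2 := Real.sq_sqrt (hp' v)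
    rw [e, abs_le]
    set s := √(p v)
    set t := √(p' v)
    rw [← h1, ← h2]
    constructor
    · nlinarith [sq_nonneg (24 * (s - t) + (s + t)), sq_nonneg (s - t)]
    · nlinarith [sq_nonneg (24 * (s - t) - (s + t)), sq_nonneg (s - t)]
  calc _ ≤ ∑ v ∈ S, (12 * (√(p v) - √(p' v)) ^ 2 + 1 / 24 * (p v + p' v)) :=
        Finset.sum_le_sum fun v _ => key v
    _ = _ := by
        rw [Finset.sum_add_distrib, ← Finset.mul_sum, ← Finset.mul_sum, Finset.sum_add_distrib,
          h, h', hellingerSq]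
        norm_num

/-- Exchanging the old and new values of coordinate `i` is an involution on pairs: resampling a
uniform coordinate preserves uniformity. -/
lemma sum_sum_update {κ α : Type*} [Fintype κ] [DecidableEq κ] [Fintype α] (i : κ)
    (G : (κ → α) → ℝ) :
    ∑ u : κ → α, ∑ a : α, G (Function.update u i a) = Fintype.card α * ∑ u : κ → α, G u := by
  have e : Function.Involutive
      (fun y : (κ → α) × α => ((Function.update y.1 i y.2, y.1 i) : (κ → α) × α)) := by
    rintro ⟨u, a⟩
    simp
  calc ∑ u : κ → α, ∑ a : α, G (Function.update u i a)
      = ∑ y : (κ → α) × α, G (Function.update y.1 i y.2) :=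
        (Fintype.sum_prod_type' (fun u a => G (Function.update u i a))).symm
    _ = ∑ y : (κ → α) × α, G y.1 :=
        Fintype.sum_equiv e.toPerm _ _ fun y => rfl
    _ = _ := by
        rw [Fintype.sum_prod_type]
        simp [Finset.mul_sum]

end Information

/-! ### Two-party intersection: cut-and-paste for rectangular functions -/

section TwoParty

variable {ι 𝒱 : Type*} [Fintype ι] [DecidableEq ι] [DecidableEq 𝒱]

/-- The joint law of (bit of the first party, label of the second party) in one coordinate, in each
of the two cases in which one of the two is constant. -/
noncomputable def bitWeight : Bool → Bool → ℝ
  | true, x => if x then 2 / 3 else 1 / 3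
  | false, x => if x then 0 else 1

noncomputable def labelWeight : Bool → Option Bool → ℝ
  | true, l => if l = none then 1 else 0
  | false, _ => 1 / 3

noncomputable def pairWeight (d : ι → Bool) (g : ι) (s : Bool × Option Bool) : ℝ :=
  bitWeight (d g) s.1 * labelWeight (d g) s.2

lemma bitWeight_nonneg (e x : Bool) : 0 ≤ bitWeight e x := by
  cases e <;> cases x <;> norm_num [bitWeight]

lemma labelWeight_nonneg (e : Bool) (l : Option Bool) : 0 ≤ labelWeight e l := by
  unfold labelWeight
  cases e
  · norm_num
  · dsimp only
    split_ifs <;> norm_num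

lemma pairWeight_nonneg (d : ι → Bool) (g : ι) (s : Bool × Option Bool) : 0 ≤ pairWeight d g s :=
  mul_nonneg (bitWeight_nonneg _ _) (labelWeight_nonneg _ _)

lemma sum_pairWeight (d : ι → Bool) (g : ι) : ∑ s, pairWeight d g s = 1 := by
  unfold pairWeight
  rw [Fintype.sum_prod_type]
  cases d g <;> simp [bitWeight, labelWeight]
  norm_num

/-- The function of the pairs that a function of the two inputs defines. -/
def onPairs (V : (ι → Bool) → (ι → Option Bool) → 𝒱) (z : ι → Bool × Option Bool) : 𝒱 :=
  V (fun g => (z g).1) (fun g => (z g).2)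

/-- The fibres of `V` are combinatorial rectangles. -/
def IsRectangular (V : (ι → Bool) → (ι → Option Bool) → 𝒱) : Prop :=
  ∀ x x' L L', V x L = V x' L' → V x L' = V x' L'

-- The indicator of a rectangular fibre is the product of the indicators of its two projections.
open Classical in
lemma productLaw_mul {V : (ι → Bool) → (ι → Option Bool) → 𝒱} (hV : IsRectangular V)
    (a : ι → Bool → ℝ) (b : ι → Option Bool → ℝ) (v : 𝒱) :
    productLaw (fun g s => a g s.1 * b g s.2) (onPairs V) v
      = (∑ x : ι → Bool, if ∃ L, V x L = v then ∏ g, a g (x g) else 0)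
        * ∑ L : ι → Option Bool, if ∃ x, V x L = v then ∏ g, b g (L g) else 0 := by
  rw [Finset.sum_mul_sum, ← Fintype.sum_prod_type'
    (fun x L => (if ∃ L, V x L = v then ∏ g, a g (x g) else 0)
      * (if ∃ x, V x L = v then ∏ g, b g (L g) else 0))]
  unfold productLaw
  refine Fintype.sum_equiv (Equiv.arrowProdEquivProdArrow ι (fun _ => Bool) (fun _ => Option Bool))
    _ _ fun z => ?_
  rw [Finset.prod_mul_distrib]
  change (if V (fun g => (z g).1) (fun g => (z g).2) = v then _ else _)
    = (if ∃ L, V (fun g => (z g).1) L = v then _ else _)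
    * (if ∃ x, V x (fun g => (z g).2) = v then _ else _)
  by_cases h : V (fun g => (z g).1) (fun g => (z g).2) = v
  · rw [if_pos h, if_pos ⟨_, h⟩, if_pos ⟨_, h⟩]
    rfl
  · rw [if_neg h]
    by_cases h1 : ∃ L, V (fun g => (z g).1) L = v
    · by_cases h2 : ∃ x, V x (fun g => (z g).2) = v
      · obtain ⟨L, h1⟩ := h1
        obtain ⟨x, h2⟩ := h2
        exact absurd ((hV _ _ _ _ (h1.trans h2.symm)).trans h2) h
      · rw [if_neg h2, mul_zero]
    · rw [if_neg h1, zero_mul]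

-- For fixed cases `d` the bit and the label of each coordinate are independent, and pinning a
-- coordinate keeps them so.
open Classical in
lemma productLaw_pinned_pairWeight {V : (ι → Bool) → (ι → Option Bool) → 𝒱} (hV : IsRectangular V)
    (d : ι → Bool) (f : ι) :
    ∃ (α : Bool → 𝒱 → ℝ) (β : Option Bool → 𝒱 → ℝ), (∀ x v, 0 ≤ α x v) ∧ (∀ l v, 0 ≤ β l v) ∧
      ∀ x l v, productLaw (pinned (pairWeight d) f (x, l)) (onPairs V) v = α x v * β l v := by
  refine ⟨fun x v => ∑ y : ι → Bool, if ∃ L, V y L = v then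
      ∏ g, pinned (fun g => bitWeight (d g)) f x g (y g) else 0,
    fun l v => ∑ L : ι → Option Bool, if ∃ x, V x L = v then
      ∏ g, pinned (fun g => labelWeight (d g)) f l g (L g) else 0, ?_, ?_, ?_⟩
  · intro x v
    refine Finset.sum_nonneg fun y _ => ?_
    split_ifs
    · exact Finset.prod_nonneg fun g _ => pinned_nonneg (fun g s => bitWeight_nonneg _ _) _ _ _ _
    · exact le_rfl
  · intro l v
    refine Finset.sum_nonneg fun y _ => ?_
    split_ifs
    · exact Finset.prod_nonneg fun g _ => pinned_nonneg (fun g s => labelWeight_nonneg _ _) _ _ _ _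
    · exact le_rfl
  · intro x l v
    rw [← productLaw_mul hV]
    congr 1
    funext g s
    by_cases h : g = f
    · subst h
      obtain ⟨y, l'⟩ := s
      simp only [pinned, Function.update_self, Pi.single_apply, Prod.mk.injEq]
      split_ifs <;> simp_all
    · simp [pinned, h, pairWeight]

/-- The distance depends only on the affinity, whose terms are products of four roots, unchanged
when `x` and `x'` are exchanged. -/
lemma hellingerSq_cut_paste {S : Finset 𝒱} {α : Bool → 𝒱 → ℝ} {β : Option Bool → 𝒱 → ℝ}
    (hα : ∀ x v, 0 ≤ α x v) (hβ : ∀ l v, 0 ≤ β l v) (h1 : ∀ x l, ∑ v ∈ S, α x v * β l v = 1)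
    (x x' : Bool) (l l' : Option Bool) :
    hellingerSq S (fun v => α x v * β l v) (fun v => α x' v * β l' v)
      = hellingerSq S (fun v => α x' v * β l v) (fun v => α x v * β l' v) := by
  have key : ∀ x x' l l', hellingerSq S (fun v => α x v * β l v) (fun v => α x' v * β l' v)
      = 2 - 2 * ∑ v ∈ S, √(α x v) * √(β l v) * (√(α x' v) * √(β l' v)) := by
    intro x x' l l'
    unfold hellingerSq
    have e : ∀ v, (√(α x v * β l v) - √(α x' v * β l' v)) ^ 2
        = α x v * β l v + α x' v * β l' v
          - 2 * (√(α x v) * √(β l v) * (√(α x' v) * √(β l' v))) := by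
      intro v
      rw [sub_sq, Real.sq_sqrt (mul_nonneg (hα _ _) (hβ _ _)),
        Real.sq_sqrt (mul_nonneg (hα _ _) (hβ _ _)), Real.sqrt_mul (hα _ _),
        Real.sqrt_mul (hα _ _)]
      ring
    simp only [e]
    rw [Finset.sum_sub_distrib, Finset.sum_add_distrib, h1, h1, ← Finset.mul_sum]
    norm_num
  rw [key, key]
  congr 2
  exact Finset.sum_congr rfl fun v _ => by ring

/-- Pinning overwrites coordinate `f`, so the case `d f` is forgotten. Hence the same pinned laws
can be compared in both cases. -/
lemma pinned_pairWeight_update (d : ι → Bool) (f : ι) (e : Bool) (s : Bool × Option Bool) :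
    pinned (pairWeight (Function.update d f e)) f s = pinned (pairWeight d) f s := by
  funext g t
  by_cases h : g = f
  · subst h; simp [pinned]
  · simp [pinned, h, pairWeight]

/-- The information about coordinate `f` that `V` contains. -/
noncomputable def coordInfo (S : Finset 𝒱) (V : (ι → Bool × Option Bool) → 𝒱) (f : ι)
    (d : ι → Bool) : ℝ :=
  ∑ s, pairWeight d f s *
    hellingerSq S (productLaw (pinned (pairWeight d) f s) V) (productLaw (pairWeight d) V)

/-- Both values have mass at least `1 / 3`; passing through the unpinned law costs a factor 2, so 6
in all. -/
lemma hellingerSq_pinned_le (S : Finset 𝒱) (V : (ι → Bool × Option Bool) → 𝒱) (f : ι)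
    (d : ι → Bool) {s s' : Bool × Option Bool} (hne : s ≠ s') (hs : 1 / 3 ≤ pairWeight d f s)
    (hs' : 1 / 3 ≤ pairWeight d f s') :
    hellingerSq S (productLaw (pinned (pairWeight d) f s) V)
      (productLaw (pinned (pairWeight d) f s') V) ≤ 6 * coordInfo S V f d := by
  have h1 := hellingerSq_triangle S (productLaw (pinned (pairWeight d) f s) V)
    (productLaw (pairWeight d) V) (productLaw (pinned (pairWeight d) f s') V)
  rw [hellingerSq_comm S (productLaw (pairWeight d) V)] at h1
  have h2 : ∑ t ∈ {s, s'}, pairWeight d f t * hellingerSq S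
      (productLaw (pinned (pairWeight d) f t) V) (productLaw (pairWeight d) V)
      ≤ coordInfo S V f d :=
    Finset.sum_le_sum_of_subset_of_nonneg (Finset.subset_univ _) fun t _ _ =>
      mul_nonneg (pairWeight_nonneg _ _ _) (hellingerSq_nonneg _ _ _)
  rw [Finset.sum_pair hne] at h2
  have h3 := mul_le_mul_of_nonneg_right hs (hellingerSq_nonneg S
    (productLaw (pinned (pairWeight d) f s) V) (productLaw (pairWeight d) V))
  have h4 := mul_le_mul_of_nonneg_right hs' (hellingerSq_nonneg S
    (productLaw (pinned (pairWeight d) f s') V) (productLaw (pairWeight d) V))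
  linarith

/-- By cut-and-paste the distance equals that of `(true, none)` and `(false, some y)`. The path
through `(false, none)` has one leg controlled in the case `d f = true` and one in the case `d f =
false`, so both cases are summed. -/
lemma sum_hellingerSq_intersect_le {S : Finset 𝒱} {V : (ι → Bool) → (ι → Option Bool) → 𝒱}
    (hV : IsRectangular V) (hS : ∀ z, onPairs V z ∈ S) (f : ι) (y : Bool) :
    ∑ d : ι → Bool, hellingerSq S (productLaw (pinned (pairWeight d) f (false, none)) (onPairs V))
        (productLaw (pinned (pairWeight d) f (true, some y)) (onPairs V))
      ≤ 24 * ∑ d : ι → Bool, coordInfo S (onPairs V) f d := by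
  have key : ∀ d : ι → Bool,
      hellingerSq S (productLaw (pinned (pairWeight d) f (false, none)) (onPairs V))
        (productLaw (pinned (pairWeight d) f (true, some y)) (onPairs V))
      ≤ 12 * ∑ e : Bool, coordInfo S (onPairs V) f (Function.update d f e) := by
    intro d
    obtain ⟨α, β, hα, hβ, hαβ⟩ := productLaw_pinned_pairWeight hV d f
    have hp : ∀ x l, productLaw (pinned (pairWeight d) f (x, l)) (onPairs V)
        = fun v => α x v * β l v := fun x l => funext (hαβ x l)
    have h1 : ∀ x l, ∑ v ∈ S, α x v * β l v = 1 := by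
      intro x l
      rw [← sum_productLaw hS (sum_pinned (sum_pairWeight d) f (x, l)), hp]
    have ht := hellingerSq_pinned_le S (onPairs V) f (Function.update d f true)
      (s := (true, none)) (s' := (false, none)) (by simp)
      (by norm_num [pairWeight, bitWeight, labelWeight])
      (by norm_num [pairWeight, bitWeight, labelWeight])
    have hf := hellingerSq_pinned_le S (onPairs V) f (Function.update d f false)
      (s := (false, none)) (s' := (false, some y)) (by simp)
      (by norm_num [pairWeight, bitWeight, labelWeight])
      (by norm_num [pairWeight, bitWeight, labelWeight])
    simp only [pinned_pairWeight_update] at ht hf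
    rw [hp, hp] at ht hf ⊢
    rw [hellingerSq_cut_paste hα hβ h1]
    have := hellingerSq_triangle S (fun v => α true v * β none v)
      (fun v => α false v * β none v) (fun v => α false v * β (some y) v)
    rw [Fintype.sum_bool]
    linarith
  calc _ ≤ ∑ d : ι → Bool, 12 * ∑ e : Bool, coordInfo S (onPairs V) f (Function.update d f e) :=
        Finset.sum_le_sum fun d _ => key d
    _ = _ := by
        rw [← Finset.mul_sum, sum_sum_update f (coordInfo S (onPairs V) f)]
        simp
        ring

/-- The expectation of `F` when the coordinates have the weights `pairWeight d`, except that
coordinate `f` is an intersection of type `y`. -/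
noncomputable def intersectExp (d : ι → Bool) (f : ι) (y : Bool)
    (F : (ι → Bool) → (ι → Option Bool) → ℝ) : ℝ :=
  ∑ z, (∏ g, pinned (pairWeight d) f (true, some y) g (z g)) * onPairs F z

lemma intersectExp_sub_le {S : Finset 𝒱} {V : (ι → Bool) → (ι → Option Bool) → 𝒱}
    (hS : ∀ z, onPairs V z ∈ S) {φ : 𝒱 → ℝ} (h0 : ∀ v, 0 ≤ φ v) (h1 : ∀ v, φ v ≤ 1)
    (d : ι → Bool) (f : ι) :
    intersectExp d f true (fun x L => φ (V x L)) - intersectExp d f false (fun x L => φ (V x L))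
      ≤ 12 * (hellingerSq S (productLaw (pinned (pairWeight d) f (false, none)) (onPairs V))
        (productLaw (pinned (pairWeight d) f (true, some true)) (onPairs V))
        + hellingerSq S (productLaw (pinned (pairWeight d) f (false, none)) (onPairs V))
        (productLaw (pinned (pairWeight d) f (true, some false)) (onPairs V))) + 1 / 6 := by
  have e : ∀ y, intersectExp d f y (fun x L => φ (V x L))
      = ∑ v ∈ S, φ v * productLaw (pinned (pairWeight d) f (true, some y)) (onPairs V) v := by
    intro y
    unfold intersectExp productLaw
    rw [← sum_fiberwise_law hS]
    refine Finset.sum_congr rfl fun v _ => ?_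
    rw [Finset.mul_sum]
    refine Finset.sum_congr rfl fun z _ => ?_
    by_cases h : onPairs V z = v
    · rw [if_pos h, if_pos h, mul_comm, ← h]
      rfl
    · simp [h]
  have hn : ∀ s v, 0 ≤ productLaw (pinned (pairWeight d) f s) (onPairs V) v := fun s =>
    productLaw_nonneg (pinned_nonneg (pairWeight_nonneg d) f s) _
  have hs : ∀ s, ∑ v ∈ S, productLaw (pinned (pairWeight d) f s) (onPairs V) v = 1 := fun s =>
    sum_productLaw hS (sum_pinned (sum_pairWeight d) f s)
  have t := sum_abs_sub_le (hn (false, none)) (hn (true, some true)) (hs _) (hs _)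
  have t' := sum_abs_sub_le (hn (false, none)) (hn (true, some false)) (hs _) (hs _)
  rw [e, e, ← Finset.sum_sub_distrib]
  have : ∑ v ∈ S, (φ v * productLaw (pinned (pairWeight d) f (true, some true)) (onPairs V) v
      - φ v * productLaw (pinned (pairWeight d) f (true, some false)) (onPairs V) v)
      ≤ ∑ v ∈ S, (|productLaw (pinned (pairWeight d) f (false, none)) (onPairs V) v
        - productLaw (pinned (pairWeight d) f (true, some true)) (onPairs V) v|
        + |productLaw (pinned (pairWeight d) f (false, none)) (onPairs V) v
        - productLaw (pinned (pairWeight d) f (true, some false)) (onPairs V) v|) := by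
    refine Finset.sum_le_sum fun v _ => ?_
    set a := productLaw (pinned (pairWeight d) f (false, none)) (onPairs V) v
    set b := productLaw (pinned (pairWeight d) f (true, some true)) (onPairs V) v
    set c := productLaw (pinned (pairWeight d) f (true, some false)) (onPairs V) v
    have h2 : φ v * (b - c) ≤ |b - c| :=
      (mul_le_mul_of_nonneg_left (le_abs_self _) (h0 v)).trans
        (mul_le_of_le_one_left (abs_nonneg _) (h1 v))
    have h3 : |b - c| ≤ |b - a| + |a - c| := abs_sub_le b a c
    rw [abs_sub_comm b a] at h3
    linarith
  rw [Finset.sum_add_distrib] at this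
  linarith

/-- A rectangular `V` with a short code does not tell apart the two types of intersection. -/
theorem sum_intersectExp_sub_le {S : Finset 𝒱} {V : (ι → Bool) → (ι → Option Bool) → 𝒱}
    (hV : IsRectangular V) (hS : ∀ z, onPairs V z ∈ S) {q : 𝒱 → ℝ} (hq : ∀ v, 0 < q v)
    (hqS : ∑ v ∈ S, q v ≤ 1) {φ : 𝒱 → ℝ} (h0 : ∀ v, 0 ≤ φ v) (h1 : ∀ v, φ v ≤ 1) :
    ∑ d : ι → Bool, ∑ f, (intersectExp d f true (fun x L => φ (V x L))
        - intersectExp d f false (fun x L => φ (V x L)))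
      ≤ 576 * ∑ d : ι → Bool, ∑ z, (∏ g, pairWeight d g (z g)) * -Real.log (q (onPairs V z))
        + 2 ^ Fintype.card ι * Fintype.card ι / 6 := by
  have hI : ∑ d : ι → Bool, ∑ f, coordInfo S (onPairs V) f d
      ≤ ∑ d : ι → Bool, ∑ z, (∏ g, pairWeight d g (z g)) * -Real.log (q (onPairs V z)) :=
    Finset.sum_le_sum fun d _ =>
      sum_hellingerSq_pinned_le (pairWeight_nonneg d) (sum_pairWeight d) hS hq hqS
  rw [Finset.sum_comm] at hI
  have hH : ∀ y, ∑ f, ∑ d : ι → Bool,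
      hellingerSq S (productLaw (pinned (pairWeight d) f (false, none)) (onPairs V))
        (productLaw (pinned (pairWeight d) f (true, some y)) (onPairs V))
      ≤ 24 * ∑ f, ∑ d : ι → Bool, coordInfo S (onPairs V) f d := by
    intro y
    rw [Finset.mul_sum]
    exact Finset.sum_le_sum fun f _ => sum_hellingerSq_intersect_le hV hS f y
  have ht := hH true
  have hf := hH false
  rw [Finset.sum_comm]
  calc _ ≤ ∑ f, ∑ d : ι → Bool,
        (12 * (hellingerSq S (productLaw (pinned (pairWeight d) f (false, none)) (onPairs V))
        (productLaw (pinned (pairWeight d) f (true, some true)) (onPairs V))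
        + hellingerSq S (productLaw (pinned (pairWeight d) f (false, none)) (onPairs V))
        (productLaw (pinned (pairWeight d) f (true, some false)) (onPairs V))) + 1 / 6) :=
        Finset.sum_le_sum fun f _ => Finset.sum_le_sum fun d _ => intersectExp_sub_le hS h0 h1 d f
    _ ≤ _ := by
        simp only [Finset.sum_add_distrib, ← Finset.mul_sum]
        have hc : ∑ f : ι, ∑ d : ι → Bool, (1 / 6 : ℝ)
            = 2 ^ Fintype.card ι * Fintype.card ι / 6 := by
          simp
          ring
        rw [hc]
        linarith

end TwoParty
-- Executions of protocols: views, rectangularity, fixing the tapes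
lemma Transcript.view_cons {k : ℕ} (i : Fin k) (e : Message k) (T : Transcript k) :
    Transcript.view i (e :: T)
      = if e.sender = i ∨ e.receiver = i then e :: T.view i else T.view i := by
  simp [Transcript.view, List.filter_cons]

/-- Each bit is seen only by its sender and its receiver. This is where point-to-point communication
enters. -/
lemma Transcript.sum_length_view_le {k : ℕ} (T : Transcript k) :
    ∑ i, (Transcript.view i T).length ≤ 2 * T.length := by
  induction T with
  | nil => simp [Transcript.view]
  | cons e T ih =>
    have h : ∀ i, (Transcript.view i (e :: T)).length
        ≤ (Transcript.view i T).length
          + ((if e.sender = i then 1 else 0) + if e.receiver = i then 1 else 0) := by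
      intro i
      rw [Transcript.view_cons]
      by_cases h1 : e.sender = i <;> by_cases h2 : e.receiver = i <;> simp [h1, h2]
    calc _ ≤ ∑ i, ((Transcript.view i T).length
          + ((if e.sender = i then 1 else 0) + if e.receiver = i then 1 else 0)) :=
          Finset.sum_le_sum fun i _ => h i
      _ = ∑ i, (Transcript.view i T).length + 2 := by
          simp [Finset.sum_add_distrib]
      _ ≤ _ := by
          rw [List.length_cons]
          omega

namespace Protocol

variable {k : ℕ} {X : Fin k → Type} (P : Protocol k X)

/-- The bits that player `i` sends in a view are those that it sends on input `a` and tape `r`. -/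
def Consistent (i : Fin k) (a : X i) (r : P.Tape i) : Transcript k → Prop
  | [] => True
  | e :: S => (e.sender = i → e.bit = P.bit i a r S) ∧ Consistent i a r S

lemma transcript_succ (x : ∀ i, X i) (ω : ∀ i, P.Tape i) (t : ℕ) :
    P.transcript x ω (t + 1) = P.step x ω (P.transcript x ω t) :=
  Function.iterate_succ_apply' _ _ _

lemma consistent_view (x : ∀ i, X i) (ω : ∀ i, P.Tape i) (i : Fin k) (t : ℕ) :
    P.Consistent i (x i) (ω i) ((P.transcript x ω t).view i) := by
  induction t with
  | zero => simp [transcript, Transcript.view, Consistent]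
  | succ t ih =>
    rw [transcript_succ, step]
    cases h : P.next (P.transcript x ω t) with
    | halt j => exact ih
    | send s r hsr =>
      simp only [Transcript.view_cons]
      split_ifs
      · refine ⟨fun hs => ?_, ih⟩
        simp only at hs
        subst hs
        rfl
      · exact ih

/-- If the new input makes player `i` send the same bits, the execution cannot change: all other
bits come from unchanged inputs and the same views. -/
lemma transcript_update (x : ∀ i, X i) (ω : ∀ i, P.Tape i) (i : Fin k) (a : X i) (t : ℕ)
    (h : P.Consistent i a (ω i) ((P.transcript x ω t).view i)) :
    P.transcript (Function.update x i a) ω t = P.transcript x ω t := by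
  induction t with
  | zero => rfl
  | succ t ih =>
    rw [transcript_succ, step] at h
    rw [transcript_succ, transcript_succ]
    cases hn : P.next (P.transcript x ω t) with
    | halt j =>
      simp only [hn] at h
      rw [ih h, step, step, hn]
    | send s r hsr =>
      simp only [hn, Transcript.view_cons] at h
      have hc : P.Consistent i a (ω i) ((P.transcript x ω t).view i) := by
        split_ifs at h
        · exact h.2
        · exact h
      rw [ih hc, step, step, hn]
      simp only
      congr 2
      by_cases hs : s = i
      · subst hs
        rw [if_pos (Or.inl rfl)] at h
        rw [Function.update_self]
        exact (h.1 rfl).symm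
      · rw [Function.update_of_ne hs]

lemma length_transcript_le (x : ∀ i, X i) (ω : ∀ i, P.Tape i) (t : ℕ) :
    (P.transcript x ω t).length ≤ t := by
  induction t with
  | zero => simp [transcript]
  | succ t ih =>
    rw [transcript_succ, step]
    split
    · simpa using ih
    · omega

lemma transcript_eq_of_halt {x : ∀ i, X i} {ω : ∀ i, P.Tape i} {t : ℕ} {i : Fin k}
    (h : P.next (P.transcript x ω t) = .halt i) {s : ℕ} (hs : t ≤ s) :
    P.transcript x ω s = P.transcript x ω t := by
  induction s, hs using Nat.le_induction with
  | base => rfl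
  | succ s _ ih => rw [transcript_succ, ih, step, h]

lemma halts_or_length_eq (x : ∀ i, X i) (ω : ∀ i, P.Tape i) (t : ℕ) :
    (∃ i, P.next (P.transcript x ω t) = .halt i) ∨ (P.transcript x ω t).length = t := by
  induction t with
  | zero => right; simp [transcript]
  | succ t ih =>
    cases hn : P.next (P.transcript x ω t) with
    | halt j => left; exact ⟨j, by rw [P.transcript_eq_of_halt hn (Nat.le_succ t), hn]⟩
    | send s r hsr =>
      right
      rcases ih with ⟨j, hj⟩ | ih
      · rw [hj] at hn; cases hn
      · rw [transcript_succ, step, hn]; simp [ih]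

/-- Every step before halting adds a bit, so an execution with at most `C` bits has stopped after
`C` steps. -/
lemma exists_halt {x : ∀ i, X i} {ω : ∀ i, P.Tape i} {C : ℕ} (h : P.bits x ω ≤ C) :
    ∃ i, P.next (P.transcript x ω C) = .halt i := by
  rcases P.halts_or_length_eq x ω (C + 1) with ⟨i, hi⟩ | hl
  · rcases P.halts_or_length_eq x ω C with hC | hC
    · exact hC
    · cases hn : P.next (P.transcript x ω C) with
      | halt j => exact ⟨j, rfl⟩
      | send s r hsr =>
        have h1 : ((P.transcript x ω (C + 1)).length : ℕ∞) ≤ C :=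
          (le_iSup (fun t => ((P.transcript x ω t).length : ℕ∞)) (C + 1)).trans h
        rw [transcript_succ, step, hn] at h1
        simp only [List.length_cons, hC] at h1
        have : C + 1 ≤ C := by exact_mod_cast h1
        omega
  · have h1 : ((P.transcript x ω (C + 1)).length : ℕ∞) ≤ C :=
      (le_iSup (fun t => ((P.transcript x ω t).length : ℕ∞)) (C + 1)).trans h
    rw [hl] at h1
    have : C + 1 ≤ C := by exact_mod_cast h1
    omega

/-- Whether the transcript is complete and player `i` announces the answer. -/
def haltsAt (i : Fin k) (T : Transcript k) : Bool :=
  match P.next T with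
  | .halt j => decide (j = i)
  | .send _ _ _ => false

/-- The announced answer, or `false` if the transcript is not complete. -/
def announced (x : ∀ i, X i) (ω : ∀ i, P.Tape i) (T : Transcript k) : Bool :=
  match P.next T with
  | .halt j => P.answer j (x j) (ω j) (T.view j)
  | .send _ _ _ => false

lemma announced_eq_of_outputs {x : ∀ i, X i} {ω : ∀ i, P.Tape i} {C : ℕ} (h : P.bits x ω ≤ C)
    {b : Bool} (hb : P.Outputs x ω b) : P.announced x ω (P.transcript x ω C) = b := by
  obtain ⟨j, hj⟩ := P.exists_halt h
  obtain ⟨t, i, hi, ha⟩ := hb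
  have e : P.transcript x ω C = P.transcript x ω t := by
    rcases le_total t C with hle | hle
    · exact P.transcript_eq_of_halt hi hle
    · exact (P.transcript_eq_of_halt hj hle).symm
  rw [e, announced, hi]
  exact ha

/-- What player `i` and an outside observer of the answer see in `t` steps. -/
def observe (i : Fin k) (ω : ∀ i, P.Tape i) (t : ℕ) (x : ∀ i, X i) : Transcript k × Bool × Bool :=
  ((P.transcript x ω t).view i, P.haltsAt i (P.transcript x ω t),
    P.announced x ω (P.transcript x ω t))

/-- The flag `haltsAt` makes the announced answer behave well: either `i` announces in both
executions, from its own input and view, or another player announces after the update, with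
unchanged input. -/
lemma observe_update {i : Fin k} {ω : ∀ i, P.Tape i} {t : ℕ} {x y : ∀ i, X i}
    (h : P.observe i ω t y = P.observe i ω t x) :
    P.observe i ω t (Function.update x i (y i)) = P.observe i ω t x := by
  simp only [observe, Prod.mk.injEq] at h ⊢
  obtain ⟨hv, hh, ha⟩ := h
  have hc := P.consistent_view y ω i t
  rw [hv] at hc
  rw [P.transcript_update x ω i (y i) t hc]
  refine ⟨rfl, rfl, ?_⟩
  cases hn : P.next (P.transcript x ω t) with
  | send s r hsr => simp [announced, hn]
  | halt j =>
    by_cases hj : j = i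
    · subst hj
      rw [← ha]
      have h1 : P.haltsAt j (P.transcript y ω t) = true := by
        rw [hh, haltsAt, hn]
        simp
      have h2 : P.next (P.transcript y ω t) = .halt j := by
        cases hn' : P.next (P.transcript y ω t) with
        | send s r hsr => simp [haltsAt, hn'] at h1
        | halt j' =>
          simp only [haltsAt, hn', decide_eq_true_eq] at h1
          rw [h1]
      simp only [announced, hn, h2, Function.update_self, hv]
    · simp only [announced, hn, Function.update_of_ne hj]

/-- The second party simulates all players but `i`; their inputs may depend on `L` in any way,
through `B`. -/
lemma isRectangular_observe {ι : Type*} (i : Fin k) (ω : ∀ i, P.Tape i) (t : ℕ)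
    (B : (ι → Option Bool) → ∀ i, X i) (e : (ι → Bool) → X i) :
    IsRectangular fun x L => P.observe i ω t (Function.update (B L) i (e x)) := by
  intro x x' L L' h
  have := P.observe_update h
  simpa using this

open Classical in
/-- If every admissible input has error at most `1 / 3`, then some choice of the tapes has error at
most `1 / 3` on the average over a given finite family of admissible inputs. -/
lemma exists_tape {D : Set (∀ i, X i)} {f : (∀ i, X i) → Bool} (hP : P.Computes D f (1 / 3))
    {Θ : Type*} [Fintype Θ] {w : Θ → ℝ} (hw : ∀ θ, 0 ≤ w θ) {x : Θ → ∀ i, X i}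
    (hx : ∀ θ, w θ ≠ 0 → x θ ∈ D) :
    ∃ ω, ∑ θ, w θ * (if P.Outputs (x θ) ω (f (x θ)) then 0 else 1) ≤ 1 / 3 * ∑ θ, w θ := by
  let := P.tapeSpace
  have := P.isProb
  -- Protocols are not assumed measurable in the tapes, so the error events are replaced by
  -- measurable hulls of the same measure.
  set A : Θ → Set (∀ i, P.Tape i) := fun θ =>
    MeasureTheory.toMeasurable P.law {ω | ¬ P.Outputs (x θ) ω (f (x θ))} with hA
  have hAm : ∀ θ, MeasurableSet (A θ) := fun θ => MeasureTheory.measurableSet_toMeasurable _ _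
  set h : (∀ i, P.Tape i) → ℝ≥0∞ := fun ω =>
    ∑ θ, ENNReal.ofReal (w θ) * (A θ).indicator (fun _ => 1) ω with hh
  have hm : ∀ θ, Measurable fun ω =>
      ENNReal.ofReal (w θ) * (A θ).indicator (fun _ => (1 : ℝ≥0∞)) ω := fun θ =>
    (measurable_const.indicator (hAm θ)).const_mul _
  have hint : ∫⁻ ω, h ω ∂P.law ≤ ENNReal.ofReal (1 / 3 * ∑ θ, w θ) := by
    rw [hh, MeasureTheory.lintegral_finsetSum _ fun θ _ => hm θ, Finset.mul_sum,
      ENNReal.ofReal_sum_of_nonneg fun θ _ => mul_nonneg (by norm_num) (hw θ)]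
    refine Finset.sum_le_sum fun θ _ => ?_
    rw [MeasureTheory.lintegral_const_mul _ (measurable_const.indicator (hAm θ)),
      MeasureTheory.lintegral_indicator (hAm θ), MeasureTheory.lintegral_const,
      MeasureTheory.Measure.restrict_apply_univ, one_mul]
    by_cases h0 : w θ = 0
    · simp [h0]
    · rw [hA, MeasureTheory.measure_toMeasurable, mul_comm (1 / 3) (w θ),
        ENNReal.ofReal_mul (hw θ)]
      refine mul_le_mul_right ((hP _ (hx θ h0)).trans ?_) _
      rw [ENNReal.ofReal_div_of_pos (by norm_num)]
      simp
  obtain ⟨ω, hω⟩ := MeasureTheory.exists_le_lintegral (μ := P.law) (f := h)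
    (Finset.measurable_fun_sum _ fun θ _ => hm θ).aemeasurable
  refine ⟨ω, ?_⟩
  rw [← ENNReal.ofReal_le_ofReal_iff (mul_nonneg (by norm_num) (Finset.sum_nonneg fun θ _ => hw θ))]
  refine le_trans ?_ (hω.trans hint)
  rw [ENNReal.ofReal_sum_of_nonneg fun θ _ => mul_nonneg (hw θ) (by split_ifs <;> norm_num)]
  refine Finset.sum_le_sum fun θ _ => ?_
  rw [ENNReal.ofReal_mul (hw θ)]
  refine mul_le_mul_right ?_ _
  split_ifs with hO
  · simp
  · have : ω ∈ A θ := MeasureTheory.subset_toMeasurable _ _ hO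
    simp [this]

end Protocol

/-! ### A prefix-type code for views -/

section Code

-- There are at most `K ^ j` lists of length `j` over `K` letters, each of weight `(2K)⁻ʲ / 2`: a
-- geometric series.
open Classical in
lemma sum_list_weight_le {α : Type*} [Fintype α] (hα : 0 < Fintype.card α) (S : Finset (List α)) :
    ∑ l ∈ S, 1 / 2 * (1 / (2 * (Fintype.card α : ℝ))) ^ l.length ≤ 1 := by
  have hK : (0 : ℝ) < Fintype.card α := by exact_mod_cast hα
  set n := S.sup List.length + 1 with hn
  rw [← Finset.sum_fiberwise_of_maps_to (t := Finset.range n) (g := List.length) (by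
    intro l hl
    rw [Finset.mem_range, hn]
    exact Nat.lt_succ_of_le (Finset.le_sup (f := List.length) hl))]
  have hj : ∀ j, ∑ l ∈ S with l.length = j, 1 / 2 * (1 / (2 * (Fintype.card α : ℝ))) ^ l.length
      ≤ 1 / 2 * (1 / 2) ^ j := by
    intro j
    have hc : (S.filter fun l => l.length = j).card ≤ Fintype.card α ^ j := by
      calc _ ≤ (Finset.univ.image (List.ofFn : (Fin j → α) → List α)).card := by
            refine Finset.card_le_card fun l hl => ?_
            obtain ⟨-, rfl⟩ := Finset.mem_filter.1 hl
            exact Finset.mem_image.2 ⟨l.get, Finset.mem_univ _, List.ofFn_get l⟩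
        _ ≤ _ := Finset.card_image_le
        _ = _ := by simp
    have hc' : ((S.filter fun l => l.length = j).card : ℝ) ≤ (Fintype.card α : ℝ) ^ j := by
      exact_mod_cast hc
    calc _ = ∑ l ∈ S with l.length = j, 1 / 2 * (1 / (2 * (Fintype.card α : ℝ))) ^ j :=
          Finset.sum_congr rfl fun l hl => by rw [(Finset.mem_filter.1 hl).2]
      _ = (S.filter fun l => l.length = j).card * (1 / 2 * (1 / (2 * (Fintype.card α : ℝ))) ^ j) := by
          rw [Finset.sum_const, nsmul_eq_mul]
      _ ≤ (Fintype.card α : ℝ) ^ j * (1 / 2 * (1 / (2 * (Fintype.card α : ℝ))) ^ j) :=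
          mul_le_mul_of_nonneg_right hc' (by positivity)
      _ = 1 / 2 * (Fintype.card α * (1 / (2 * (Fintype.card α : ℝ)))) ^ j := by
          rw [mul_pow]; ring
      _ = _ := by
          congr 2
          field_simp
  calc _ ≤ ∑ j ∈ Finset.range n, 1 / 2 * (1 / 2 : ℝ) ^ j := Finset.sum_le_sum fun j _ => hj j
    _ = 1 / 2 * ∑ j ∈ Finset.range n, (1 / 2 : ℝ) ^ j := by rw [Finset.mul_sum]
    _ ≤ 1 / 2 * 2 := mul_le_mul_of_nonneg_left (sum_geometric_two_le n) (by norm_num)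
    _ = 1 := by norm_num

def messageEquiv (k : ℕ) : Message k ≃ Fin k × Fin k × Bool where
  toFun e := (e.sender, e.receiver, e.bit)
  invFun e := ⟨e.1, e.2.1, e.2.2⟩
  left_inv _ := rfl
  right_inv _ := rfl

instance (k : ℕ) : Fintype (Message k) := Fintype.ofEquiv _ (messageEquiv k).symm

lemma card_message (k : ℕ) : Fintype.card (Message k) = 2 * k ^ 2 := by
  rw [Fintype.card_congr (messageEquiv k)]
  simp
  ring

/-- The weight of an observation in a code for observations. -/
noncomputable def codeWeight {k : ℕ} (v : Transcript k × Bool × Bool) : ℝ :=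
  1 / 4 * (1 / 2 * (1 / (2 * (Fintype.card (Message k) : ℝ))) ^ v.1.length)

lemma codeWeight_pos {k : ℕ} (hk : 0 < k) (v : Transcript k × Bool × Bool) : 0 < codeWeight v := by
  have : (0 : ℝ) < Fintype.card (Message k) := by
    rw [card_message]; positivity
  unfold codeWeight
  positivity

open Classical in
lemma sum_codeWeight_le {k : ℕ} (hk : 0 < k) (S : Finset (Transcript k × Bool × Bool)) :
    ∑ v ∈ S, codeWeight v ≤ 1 := by
  calc ∑ v ∈ S, codeWeight v
      ≤ ∑ v ∈ S.image Prod.fst ×ˢ (Finset.univ : Finset (Bool × Bool)), codeWeight v := by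
        refine Finset.sum_le_sum_of_subset_of_nonneg (fun v hv => ?_)
          fun v _ _ => (codeWeight_pos hk v).le
        exact Finset.mem_product.2 ⟨Finset.mem_image_of_mem _ hv, Finset.mem_univ _⟩
    _ = ∑ l ∈ S.image Prod.fst, 1 / 2 * (1 / (2 * (Fintype.card (Message k) : ℝ))) ^ l.length := by
        rw [Finset.sum_product]
        refine Finset.sum_congr rfl fun l _ => ?_
        simp [codeWeight]
    _ ≤ 1 := sum_list_weight_le (by rw [card_message]; positivity) _

lemma neg_log_codeWeight {k : ℕ} (hk : 0 < k) (v : Transcript k × Bool × Bool) :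
    -Real.log (codeWeight v) = Real.log 8 + v.1.length * Real.log (4 * (k : ℝ) ^ 2) := by
  have e : codeWeight v = (8 * (4 * (k : ℝ) ^ 2) ^ v.1.length)⁻¹ := by
    unfold codeWeight
    rw [card_message]
    push_cast
    rw [mul_inv, ← inv_pow, one_div (2 * (2 * (k : ℝ) ^ 2)),
      show 2 * (2 * (k : ℝ) ^ 2) = 4 * (k : ℝ) ^ 2 by ring]
    ring
  have hk' : (0 : ℝ) < k := by exact_mod_cast hk
  rw [e, Real.log_inv, neg_neg, Real.log_mul (by norm_num) (by positivity), Real.log_pow]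

end Code

/-! ### Symmetrization over the players -/

section Symmetrization

variable {ι : Type*} [Fintype ι] [DecidableEq ι]

/-- The bits `u` in the coordinates with label `none`. -/
def mask (L : ι → Option Bool) (u : ι → Bool) : ι → Bool := fun g => u g && (L g).isNone

/-- The law of a label when the case is uniform: `none` has mass `1/2 + 1/2 · 1/3`. Given `none`,
the bit is `true` with probability `(1/2 · 2/3) / (2/3) = 1/2`, which explains the bias in
`bitWeight`. -/
noncomputable def commonWeight (l : Option Bool) : ℝ := if l = none then 2 / 3 else 1 / 6

lemma commonWeight_nonneg (l : Option Bool) : 0 ≤ commonWeight l := by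
  unfold commonWeight
  split_ifs <;> norm_num

lemma sum_prod_commonWeight : ∑ L : ι → Option Bool, ∏ g, commonWeight (L g) = 1 :=
  sum_prod_eq_one (w := fun _ => commonWeight) fun _ => by
    simp [commonWeight]
    norm_num

/-- On the average over the cases, the first party holds uniform bits where the label is `none`. -/
lemma sum_sum_pairWeight (G : (ι → Bool) → (ι → Option Bool) → ℝ) :
    ∑ d : ι → Bool, ∑ z, (∏ g, pairWeight d g (z g)) * onPairs G z
      = ∑ L : ι → Option Bool, ∑ u : ι → Bool, (∏ g, commonWeight (L g)) * G (mask L u) L := by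
  have h1 : ∀ z : ι → Bool × Option Bool, ∑ d : ι → Bool, ∏ g, pairWeight d g (z g)
      = ∑ u : ι → Bool, ∏ g, (if (u g && (z g).2.isNone) = (z g).1 then
          commonWeight (z g).2 else 0) := by
    intro z
    have e1 := Finset.prod_univ_sum (fun _ : ι => (Finset.univ : Finset Bool))
      (fun g e => bitWeight e (z g).1 * labelWeight e (z g).2)
    have e2 := Finset.prod_univ_sum (fun _ : ι => (Finset.univ : Finset Bool))
      (fun g e => if (e && (z g).2.isNone) = (z g).1 then commonWeight (z g).2 else 0)
    simp only [Fintype.piFinset_univ] at e1 e2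
    unfold pairWeight
    rw [← e1, ← e2]
    refine Finset.prod_congr rfl fun g _ => ?_
    obtain ⟨x, l⟩ := z g
    cases x <;> rcases l with _ | l <;>
      simp [bitWeight, labelWeight, commonWeight] <;> norm_num
  have h2 : ∀ (x : ι → Bool) (L : ι → Option Bool) (u : ι → Bool),
      (∏ g, if (u g && (L g).isNone) = x g then commonWeight (L g) else 0)
        = if mask L u = x then ∏ g, commonWeight (L g) else 0 := by
    intro x L u
    by_cases h : mask L u = x
    · rw [if_pos h]
      exact Finset.prod_congr rfl fun g _ => if_pos (congrFun h g)
    · rw [if_neg h]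
      obtain ⟨g, hg⟩ := Function.ne_iff.1 h
      exact Finset.prod_eq_zero (Finset.mem_univ g) (if_neg hg)
  rw [Finset.sum_comm]
  simp_rw [← Finset.sum_mul, h1]
  rw [← (Equiv.arrowProdEquivProdArrow ι (fun _ => Bool) (fun _ => Option Bool)).symm.sum_comp]
  rw [Fintype.sum_prod_type, Finset.sum_comm]
  refine Finset.sum_congr rfl fun L _ => ?_
  simp only [Finset.sum_mul]
  rw [Finset.sum_comm]
  refine Finset.sum_congr rfl fun u _ => ?_
  change ∑ x : ι → Bool, (∏ g, if (u g && (L g).isNone) = x g then commonWeight (L g) else 0)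
    * G x L = _
  simp only [h2, ite_mul, zero_mul]
  simp

variable {k : ℕ} {𝒢 : Type}

/-- The inputs of all players: player `j₀` holds the labels, the others hold bits. -/
def encode (c : (ι → Option Bool) → 𝒢) (e : (ι → Bool) → 𝒢) (j₀ : Fin k)
    (L : ι → Option Bool) (Y : Fin k → ι → Bool) : Fin k → 𝒢 :=
  fun j => if j = j₀ then c L else e (Y j)

lemma update_encode (c : (ι → Option Bool) → 𝒢) (e : (ι → Bool) → 𝒢) {j₀ i : Fin k} (hi : i ≠ j₀)
    (L : ι → Option Bool) (Y : Fin k → ι → Bool) (x : ι → Bool) :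
    Function.update (encode c e j₀ L Y) i (e x) = encode c e j₀ L (Function.update Y i x) := by
  funext j
  by_cases h : j = i
  · subst h; simp [encode, hi]
  · simp [encode, h]

/-- On the average over the cases and the bits of the others, the inputs have the same distribution
whichever player `i` takes the part of the first party. -/
lemma sum_player_eq (i : Fin k) (H : (ι → Option Bool) → (Fin k → ι → Bool) → ℝ) :
    ∑ u : Fin k → ι → Bool, ∑ d : ι → Bool, ∑ z, (∏ g, pairWeight d g (z g)) *
        onPairs (fun x L => H L (Function.update (fun j => mask L (u j)) i x)) z
      = 2 ^ Fintype.card ι * ∑ L : ι → Option Bool, (∏ g, commonWeight (L g))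
          * ∑ u : Fin k → ι → Bool, H L (fun j => mask L (u j)) := by
  have h : ∀ (u : Fin k → ι → Bool) (L : ι → Option Bool) (b : ι → Bool),
      Function.update (fun j => mask L (u j)) i (mask L b)
        = fun j => mask L (Function.update u i b j) := by
    intro u L b
    funext j
    by_cases hj : j = i
    · subst hj; simp
    · simp [hj]
  simp only [sum_sum_pairWeight, h]
  rw [Finset.sum_comm, Finset.mul_sum]
  refine Finset.sum_congr rfl fun L _ => ?_
  simp only [← Finset.mul_sum]
  rw [sum_sum_update i fun u => H L fun j => mask L (u j)]
  simp
  ring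

/-- Only the support matters: away from `f`, either the label is `none` or the bit is `false`, so
there is no second intersection. -/
lemma intersectExp_mono (d : ι → Bool) (f : ι) (y : Bool)
    {F F' : (ι → Bool) → (ι → Option Bool) → ℝ}
    (h : ∀ x L, x f = true → L f = some y → (∀ g ≠ f, x g = true → L g = none) →
      F x L ≤ F' x L) :
    intersectExp d f y F ≤ intersectExp d f y F' := by
  refine Finset.sum_le_sum fun z _ => ?_
  by_cases h0 : ∏ g, pinned (pairWeight d) f (true, some y) g (z g) = 0
  · simp [h0]
  · refine mul_le_mul_of_nonneg_left ?_
      (Finset.prod_nonneg fun g _ => pinned_nonneg (pairWeight_nonneg d) _ _ _ _)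
    rw [← ne_eq, Finset.prod_ne_zero_iff] at h0
    have hf : z f = (true, some y) := by
      by_contra hne
      exact h0 f (Finset.mem_univ f) (by simp [pinned, hne])
    refine h _ _ (by rw [hf]) (by rw [hf]) fun g hg hx => ?_
    by_contra hl
    refine h0 g (Finset.mem_univ g) ?_
    simp only [pinned, Function.update_of_ne hg, pairWeight]
    cases d g
    · simp [bitWeight, hx]
    · simp [labelWeight, hl]

lemma intersectExp_one (d : ι → Bool) (f : ι) (y : Bool) :
    intersectExp d f y (fun _ _ => 1) = 1 := by
  unfold intersectExp onPairs
  simp only [mul_one]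
  exact sum_prod_eq_one (sum_pinned (sum_pairWeight d) f (true, some y))

lemma intersectExp_sub (d : ι → Bool) (f : ι) (y : Bool)
    (F F' : (ι → Bool) → (ι → Option Bool) → ℝ) :
    intersectExp d f y (fun x L => F x L - F' x L)
      = intersectExp d f y F - intersectExp d f y F' := by
  unfold intersectExp onPairs
  rw [← Finset.sum_sub_distrib]
  exact Finset.sum_congr rfl fun z _ => by ring

/-- The players must find out the type of an intersection of the support of one player's bits with
the labels of player `j₀`. -/
structure EncodesIntersection (c : (ι → Option Bool) → 𝒢) (e : (ι → Bool) → 𝒢) (j₀ : Fin k)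
    (D : Set (Fin k → 𝒢)) (F : (Fin k → 𝒢) → Bool) : Prop where
  admissible : ∀ i ≠ j₀, ∀ f y L Y, L f = some y → Y i f = true →
    (∀ j g, j ≠ j₀ → (j, g) ≠ (i, f) → Y j g = true → L g = none) →
    encode c e j₀ L Y ∈ D ∧ F (encode c e j₀ L Y) = !y

open Classical in
theorem sub_one_mul_card_le {P : Protocol k (fun _ => 𝒢)} {D : Set (Fin k → 𝒢)}
    {F : (Fin k → 𝒢) → Bool} (hP : P.Computes D F (1 / 3)) {C : ℕ} (hC : P.cost D ≤ C)
    {c : (ι → Option Bool) → 𝒢} {e : (ι → Bool) → 𝒢} {j₀ : Fin k}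
    (hE : EncodesIntersection c e j₀ D F) :
    ((k : ℝ) - 1) * Fintype.card ι
      ≤ 3456 * (((k : ℝ) - 1) * Real.log 8 + 2 * C * Real.log (4 * (k : ℝ) ^ 2)) := by
  have hk : 0 < k := j₀.pos
  have hbits : ∀ x ∈ D, ∀ ω, P.bits x ω ≤ C := fun x hx ω =>
    le_trans (le_iSup₂_of_le (f := fun x (_ : x ∈ D) => ⨆ ω, P.bits x ω) x hx
      (le_iSup (fun ω => P.bits x ω) ω)) hC
  -- The bits of the other players are masked by `L`, so only player `i` can meet a label other than
  -- `none`.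
  let inp : Fin k → (Fin k → ι → Bool) → (ι → Bool) → (ι → Option Bool) → Fin k → 𝒢 :=
    fun i u x L => encode c e j₀ L (Function.update (fun j => mask L (u j)) i x)
  have hinp : ∀ i ≠ j₀, ∀ f y u x L, x f = true → L f = some y →
      (∀ g ≠ f, x g = true → L g = none) → inp i u x L ∈ D ∧ F (inp i u x L) = !y := by
    intro i hi f y u x L hx hL hg
    refine hE.admissible i hi f y L _ hL (by simpa using hx) fun j g _ hne hY => ?_
    by_cases hji : j = i
    · subst hji
      rw [Function.update_self] at hY
      exact hg g (fun h => hne (by rw [h])) hY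
    · rw [Function.update_of_ne hji] at hY
      simp only [mask, Bool.and_eq_true, Option.isNone_iff_eq_none] at hY
      exact hY.2
  let I := {i : Fin k // i ≠ j₀}
  have hcardI : (Fintype.card I : ℝ) = (k : ℝ) - 1 := by
    have h : Fintype.card I = k - 1 := by simp [I, Fintype.card_subtype_compl]
    rw [h, Nat.cast_sub hk, Nat.cast_one]
  set N := Fintype.card ι with hN
  set U : ℝ := ((Fintype.card (Fin k → ι → Bool) : ℕ) : ℝ) with hU
  have hUpos : 0 < U := by
    rw [hU]; exact_mod_cast Fintype.card_pos
  have h2N : (0 : ℝ) < 2 ^ N := by positivity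
  let err : (∀ i, P.Tape i) → (Fin k → 𝒢) → ℝ := fun ω x => if P.Outputs x ω (F x) then 0 else 1
  -- the tapes
  obtain ⟨ω, hω⟩ : ∃ ω, ∑ i : I, ∑ u : Fin k → ι → Bool, ∑ d : ι → Bool, ∑ f : ι, ∑ y : Bool,
      intersectExp d f y (fun x L => err ω (inp i u x L))
      ≤ 1 / 3 * (Fintype.card I * U * 2 ^ N * N * 2) := by
    obtain ⟨ω, hω⟩ := P.exists_tape hP
      (Θ := I × (Fin k → ι → Bool) × (ι → Bool) × ι × Bool × (ι → Bool × Option Bool))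
      (w := fun θ => ∏ g, pinned (pairWeight θ.2.2.1) θ.2.2.2.1 (true, some θ.2.2.2.2.1) g
        (θ.2.2.2.2.2 g))
      (x := fun θ => onPairs (inp θ.1 θ.2.1) θ.2.2.2.2.2)
      (fun θ => Finset.prod_nonneg fun g _ => pinned_nonneg (pairWeight_nonneg _) _ _ _ _)
      (by
        rintro ⟨i, u, d, f, y, z⟩ hne
        simp only at hne
        by_contra hD
        -- Comparing the indicator of inadmissibility with 0 shows that inadmissible inputs have no
        -- mass.
        refine absurd (intersectExp_mono d f y (F := fun x L => if inp i u x L ∈ D then 0 else 1)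
          (F' := fun _ _ => 0) fun x L hx hL hg => ?_) ?_
        · simp [(hinp i i.2 f y u x L hx hL hg).1]
        · have h0 : intersectExp d f y (fun _ _ => 0) = 0 := by simp [intersectExp, onPairs]
          rw [h0, not_le]
          refine Finset.sum_pos' (fun z _ => mul_nonneg (Finset.prod_nonneg fun g _ =>
            pinned_nonneg (pairWeight_nonneg d) _ _ _ _) ?_) ⟨z, Finset.mem_univ _, ?_⟩
          · simp only [onPairs]; split_ifs <;> norm_num
          · simp only [onPairs] at hD ⊢
            rw [if_neg hD, mul_one]
            exact lt_of_le_of_ne (Finset.prod_nonneg fun g _ =>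
              pinned_nonneg (pairWeight_nonneg d) _ _ _ _) (Ne.symm hne))
    refine ⟨ω, ?_⟩
    simp only [Fintype.sum_prod_type] at hω
    simp only [sum_prod_eq_one (sum_pinned (sum_pairWeight _) _ _)] at hω
    refine hω.trans (le_of_eq ?_)
    simp [hU, hN]
    ring
  -- what one player and the observer of the answer see
  let φ : Transcript k × Bool × Bool → ℝ := fun v => if v.2.2 then 0 else 1
  -- The information is measured on inputs without intersection, for which admissibility is not
  -- assumed. The execution is therefore cut after `C` steps, which bounds its length on every
  -- input.
  let V : Fin k → (Fin k → ι → Bool) → (ι → Bool) → (ι → Option Bool) →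
    Transcript k × Bool × Bool := fun i u x L => P.observe i ω C (inp i u x L)
  -- `φ` indicates the announcement `false`, which is correct exactly for type `true`: it is at
  -- least `1 - err` there and at most `err` for type `false`.
  have hlow : ∀ (i : I) u d f,
      1 - ∑ y : Bool, intersectExp d f y (fun x L => err ω (inp i u x L))
      ≤ intersectExp d f true (fun x L => φ (V i u x L))
        - intersectExp d f false (fun x L => φ (V i u x L)) := by
    intro i u d f
    have ht : intersectExp d f true (fun x L => 1 - err ω (inp i u x L))
        ≤ intersectExp d f true (fun x L => φ (V i u x L)) := by
      refine intersectExp_mono d f true fun x L hx hL hg => ?_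
      obtain ⟨hD, hF⟩ := hinp i i.2 f true u x L hx hL hg
      by_cases hO : P.Outputs (inp i u x L) ω (F (inp i u x L))
      · have := P.announced_eq_of_outputs (hbits _ hD ω) hO
        simp only [err, if_pos hO, φ, V, Protocol.observe, this, hF]
        simp
      · simp only [err, hO, if_false, φ]
        split_ifs <;> norm_num
    have hf : intersectExp d f false (fun x L => φ (V i u x L))
        ≤ intersectExp d f false (fun x L => err ω (inp i u x L)) := by
      refine intersectExp_mono d f false fun x L hx hL hg => ?_
      obtain ⟨hD, hF⟩ := hinp i i.2 f false u x L hx hL hg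
      by_cases hO : P.Outputs (inp i u x L) ω (F (inp i u x L))
      · have := P.announced_eq_of_outputs (hbits _ hD ω) hO
        simp only [err, if_pos hO, φ, V, Protocol.observe, this, hF]
        simp
      · simp only [err, hO, if_false, φ]
        split_ifs <;> norm_num
    rw [intersectExp_sub d f true (fun _ _ => 1), intersectExp_one] at ht
    rw [Fintype.sum_bool]
    linarith
  have hup : ∀ (i : I) (u : Fin k → ι → Bool),
      ∑ d : ι → Bool, ∑ f, (intersectExp d f true (fun x L => φ (V i u x L))
        - intersectExp d f false (fun x L => φ (V i u x L)))
      ≤ 576 * ∑ d : ι → Bool, ∑ z, (∏ g, pairWeight d g (z g))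
          * -Real.log (codeWeight (onPairs (V i u) z)) + 2 ^ N * N / 6 := by
    intro i u
    have hrect : IsRectangular (V i u) := by
      have := P.isRectangular_observe i ω C (fun L => encode c e j₀ L fun j => mask L (u j)) e
      simpa only [update_encode c e i.2] using this
    exact sum_intersectExp_sub_le (S := Finset.univ.image (onPairs (V i u))) hrect
      (fun z => Finset.mem_image_of_mem _ (Finset.mem_univ z)) (codeWeight_pos hk)
      (sum_codeWeight_le hk _) (fun v => by simp only [φ]; split_ifs <;> norm_num)
      (fun v => by simp only [φ]; split_ifs <;> norm_num)
  -- the number of bits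
  set ℓ : ℝ := Real.log (4 * (k : ℝ) ^ 2) with hℓ
  have hℓ0 : 0 ≤ ℓ := Real.log_nonneg (by
    have : (1 : ℝ) ≤ k := by exact_mod_cast hk
    nlinarith)
  let len : Fin k → (ι → Option Bool) → (Fin k → ι → Bool) → ℝ := fun i L Y =>
    ((Transcript.view i (P.transcript (encode c e j₀ L Y) ω C)).length : ℝ)
  have hlen : ∀ L Y, ∑ i : I, len i L Y ≤ 2 * C := by
    intro L Y
    have h1 : ∑ i : Fin k, len i L Y ≤ 2 * C := by
      have h2 := (Transcript.sum_length_view_le (P.transcript (encode c e j₀ L Y) ω C)).trans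
        (Nat.mul_le_mul_left 2 (P.length_transcript_le (encode c e j₀ L Y) ω C))
      simp only [len]
      exact_mod_cast h2
    have h2 := Fintype.sum_subtype_add_sum_subtype (fun i : Fin k => i ≠ j₀)
      fun i => len i L Y
    have h3 : 0 ≤ ∑ i : {i : Fin k // ¬ i ≠ j₀}, len i L Y :=
      Finset.sum_nonneg fun i _ => Nat.cast_nonneg _
    linarith
  have hcode : ∀ (i : I) (u : Fin k → ι → Bool) (d : ι → Bool),
      ∑ z, (∏ g, pairWeight d g (z g)) * -Real.log (codeWeight (onPairs (V i u) z))
        = Real.log 8 + ℓ * ∑ z, (∏ g, pairWeight d g (z g)) *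
          onPairs (fun x L => len i L (Function.update (fun j => mask L (u j)) i x)) z := by
    intro i u d
    simp only [neg_log_codeWeight hk, mul_add, Finset.sum_add_distrib, ← Finset.sum_mul,
      sum_prod_eq_one (sum_pairWeight d), one_mul]
    rw [Finset.mul_sum]
    congr 1
    refine Finset.sum_congr rfl fun z _ => ?_
    simp only [onPairs, V, inp, len, Protocol.observe, hℓ]
    ring
  have htotal : ∑ i : I, ∑ u : Fin k → ι → Bool, ∑ d : ι → Bool, ∑ z,
      (∏ g, pairWeight d g (z g)) *
        onPairs (fun x L => len i L (Function.update (fun j => mask L (u j)) i x)) z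
      ≤ 2 ^ N * (U * (2 * C)) := by
    simp only [sum_player_eq]
    rw [← Finset.mul_sum]
    refine mul_le_mul_of_nonneg_left ?_ h2N.le
    rw [Finset.sum_comm]
    calc _ ≤ ∑ L : ι → Option Bool, (∏ g, commonWeight (L g)) * (U * (2 * C)) := by
          refine Finset.sum_le_sum fun L _ => ?_
          rw [← Finset.mul_sum]
          refine mul_le_mul_of_nonneg_left ?_
            (Finset.prod_nonneg fun g _ => commonWeight_nonneg _)
          rw [Finset.sum_comm]
          calc _ ≤ ∑ u : Fin k → ι → Bool, (2 * (C : ℝ)) :=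
                Finset.sum_le_sum fun u _ => hlen _ _
            _ = _ := by rw [Finset.sum_const, nsmul_eq_mul, Finset.card_univ]
      _ = _ := by rw [← Finset.sum_mul, sum_prod_commonWeight, one_mul]
  have hA : ∑ i : I, ∑ u : Fin k → ι → Bool, ∑ d : ι → Bool, ∑ f : ι,
      (1 - ∑ y : Bool, intersectExp d f y (fun x L => err ω (inp i u x L)))
      ≤ ∑ i : I, ∑ u : Fin k → ι → Bool, (576 * ∑ d : ι → Bool, ∑ z, (∏ g, pairWeight d g (z g))
          * -Real.log (codeWeight (onPairs (V i u) z)) + 2 ^ N * N / 6) :=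
    Finset.sum_le_sum fun i _ => Finset.sum_le_sum fun u _ =>
      (Finset.sum_le_sum fun d _ => Finset.sum_le_sum fun f _ => hlow i u d f).trans (hup i u)
  have hL : ∑ i : I, ∑ u : Fin k → ι → Bool, ∑ d : ι → Bool, ∑ f : ι,
      (1 - ∑ y : Bool, intersectExp d f y (fun x L => err ω (inp i u x L)))
      = Fintype.card I * U * 2 ^ N * N - ∑ i : I, ∑ u : Fin k → ι → Bool, ∑ d : ι → Bool,
        ∑ f : ι, ∑ y : Bool, intersectExp d f y (fun x L => err ω (inp i u x L)) := by
    simp only [Finset.sum_sub_distrib]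
    congr 1
    simp [hU, hN]
    ring
  have hR : ∑ i : I, ∑ u : Fin k → ι → Bool, (576 * ∑ d : ι → Bool, ∑ z,
      (∏ g, pairWeight d g (z g)) * -Real.log (codeWeight (onPairs (V i u) z)) + 2 ^ N * N / 6)
      = 576 * (Fintype.card I * U * 2 ^ N * Real.log 8 + ℓ * ∑ i : I, ∑ u : Fin k → ι → Bool,
        ∑ d : ι → Bool, ∑ z, (∏ g, pairWeight d g (z g)) *
        onPairs (fun x L => len i L (Function.update (fun j => mask L (u j)) i x)) z)
        + Fintype.card I * U * (2 ^ N * N / 6) := by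
    simp only [hcode, Finset.sum_add_distrib, ← Finset.mul_sum]
    congr 1
    · congr 2
      simp [hU, hN]
      ring
    · simp [hU]
      ring
  rw [hL, hR] at hA
  rw [hcardI] at hA hω
  have hB := mul_le_mul_of_nonneg_left htotal hℓ0
  -- The two types have total error at most `2 / 3` on average. The advantage `1 / 3` minus the loss
  -- `1 / 6` leaves `1 / 6`, and `3456 = 6 · 576`.
  have hfin : (U * 2 ^ N) * (((k : ℝ) - 1) * N)
      ≤ (U * 2 ^ N) * (3456 * (((k : ℝ) - 1) * Real.log 8 + 2 * C * ℓ)) := by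
    nlinarith
  exact le_of_mul_le_mul_left hfin (by positivity)

end Symmetrization

/-! ### The graph gadget -/

/-- Vertices of the hard instances: `a`, `c` are matched to each other, both are joined to the
`b`, and `d`, `e` are the sides of a bipartite graph that fixes the number of edges. -/
inductive Vertex (p r q : ℕ) where
  | a (i : Fin p) : Vertex p r q
  | c (i : Fin p) : Vertex p r q
  | b (j : Fin r) : Vertex p r q
  | d (x : Fin q) : Vertex p r q
  | e (x : Fin q) : Vertex p r q

namespace Vertex

variable {p r q n : ℕ}

def toNat : Vertex p r q → ℕ
  | a i => i
  | c i => p + i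
  | b j => 2 * p + j
  | d x => 2 * p + r + x
  | e x => 2 * p + r + q + x

lemma toNat_lt (v : Vertex p r q) : v.toNat < 2 * p + r + 2 * q := by
  cases v <;> simp only [toNat] <;> omega

lemma toNat_injective : Function.Injective (toNat : Vertex p r q → ℕ) := by
  intro v w h
  cases v <;> cases w <;> simp only [toNat] at h <;>
    first | (congr 1; apply Fin.ext; omega) | (exfalso; omega)

def toFin (h : 2 * p + r + 2 * q ≤ n) : Vertex p r q ↪ Fin n where
  toFun v := ⟨v.toNat, v.toNat_lt.trans_le h⟩
  inj' v w hvw := toNat_injective (by simpa using hvw)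

instance : Finite (Vertex p r q) := Finite.of_injective _ (toFin (le_refl _)).injective

/-- The edge that a player holds if it has `g`. -/
def slotEdge (g : Fin p × Fin r) : Sym2 (Vertex p r q) := s(a g.1, b g.2)

/-- For label `none` the centre owns the slot edge itself, so that copies held by other players do
not change the union. -/
def baseEdges (L : Fin p × Fin r → Option Bool) : Set (Sym2 (Vertex p r q)) :=
  {E | (∃ i, E = s(a i, c i)) ∨ (∃ g, L g = none ∧ E = slotEdge g) ∨
    ∃ g, L g = some true ∧ E = s(c g.1, b g.2)}

def padEdges : Set (Sym2 (Vertex p r q)) := {E | ∃ x y, E = s(d x, e y)}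

lemma ncard_baseEdges_le (L : Fin p × Fin r → Option Bool) :
    (baseEdges L : Set (Sym2 (Vertex p r q))).ncard ≤ p + p * r := by
  let F : Fin p ⊕ Fin p × Fin r → Sym2 (Vertex p r q) :=
    Sum.elim (fun i => s(a i, c i)) fun g => if L g = none then slotEdge g else s(c g.1, b g.2)
  have h : (baseEdges L : Set (Sym2 (Vertex p r q))) ⊆ F '' Set.univ := by
    rintro E (⟨i, rfl⟩ | ⟨g, hg, rfl⟩ | ⟨g, hg, rfl⟩)
    · exact ⟨Sum.inl i, trivial, rfl⟩
    · exact ⟨Sum.inr g, trivial, by simp [F, hg]⟩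
    · exact ⟨Sum.inr g, trivial, by simp [F, hg]⟩
  calc _ ≤ (F '' Set.univ).ncard := Set.ncard_le_ncard h (Set.toFinite _)
    _ ≤ (Set.univ : Set (Fin p ⊕ Fin p × Fin r)).ncard := Set.ncard_image_le (Set.toFinite _)
    _ = _ := by simp [Set.ncard_univ]

lemma le_ncard_padEdges : q * q ≤ (padEdges : Set (Sym2 (Vertex p r q))).ncard := by
  let F : Fin q × Fin q → Sym2 (Vertex p r q) := fun z => s(d z.1, e z.2)
  have hF : Function.Injective F := by
    rintro ⟨x, y⟩ ⟨x', y'⟩ h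
    simpa [F] using h
  calc q * q = (F '' Set.univ).ncard := by
        rw [Set.ncard_image_of_injective _ hF]
        simp [Set.ncard_univ]
    _ ≤ _ := Set.ncard_le_ncard (by rintro _ ⟨z, -, rfl⟩; exact ⟨z.1, z.2, rfl⟩) (Set.toFinite _)

/-- The padding absorbs the dependence of the number of base edges on `L`. -/
lemma exists_centerEdges {M : ℕ} (h : p + p * r ≤ M) (hM : M ≤ q * q)
    (L : Fin p × Fin r → Option Bool) :
    ∃ E : Set (Sym2 (Vertex p r q)), baseEdges L ⊆ E ∧ E ⊆ baseEdges L ∪ padEdges ∧ E.ncard = M :=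
  Set.exists_subsuperset_card_eq Set.subset_union_left ((ncard_baseEdges_le L).trans h)
    (hM.trans (le_ncard_padEdges.trans
      (Set.ncard_le_ncard Set.subset_union_right (Set.toFinite _))))

lemma not_isDiag_of_mem {L : Fin p × Fin r → Option Bool} {f : Fin p × Fin r}
    {E : Sym2 (Vertex p r q)} (hE : E ∈ insert (slotEdge f) (baseEdges L ∪ padEdges)) :
    ¬ E.IsDiag := by
  rcases hE with rfl | (⟨i, rfl⟩ | ⟨g, hg, rfl⟩ | ⟨g, hg, rfl⟩) | ⟨x, y, rfl⟩ <;>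
    simp [slotEdge]

lemma slotEdge_notMem {L : Fin p × Fin r → Option Bool} {f : Fin p × Fin r} (hf : L f ≠ none) :
    (slotEdge f : Sym2 (Vertex p r q)) ∉ baseEdges L ∪ padEdges := by
  rintro ((⟨i, h⟩ | ⟨g, hg, h⟩ | ⟨g, hg, h⟩) | ⟨x, y, h⟩)
  · simp [slotEdge] at h
  · simp [slotEdge] at h
    exact hf (by rw [Prod.ext h.1 h.2, hg])
  · simp [slotEdge] at h
  · simp [slotEdge] at h

/-- The edges that may occur, oriented. -/
def Arc (L : Fin p × Fin r → Option Bool) (f : Fin p × Fin r) : Vertex p r q → Vertex p r q → Prop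
  | a i, c i' => i = i'
  | a i, b j => (i, j) = f ∨ L (i, j) = none
  | c i, b j => L (i, j) = some true
  | d _, e _ => True
  | _, _ => False

lemma arc_or_arc_of_mem {L : Fin p × Fin r → Option Bool} {f : Fin p × Fin r}
    {v w : Vertex p r q} (h : s(v, w) ∈ insert (slotEdge f) (baseEdges L ∪ padEdges)) :
    Arc L f v w ∨ Arc L f w v := by
  rcases h with h | (⟨i, h⟩ | ⟨g, hg, h⟩ | ⟨g, hg, h⟩) | ⟨x, y, h⟩ <;>
    rcases Sym2.eq_iff.1 h with ⟨rfl, rfl⟩ | ⟨rfl, rfl⟩ <;> simp_all [Arc]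

lemma Arc.toNat_lt {L : Fin p × Fin r → Option Bool} {f : Fin p × Fin r} {v w : Vertex p r q}
    (h : Arc L f v w) : v.toNat < w.toNat := by
  cases v <;> cases w <;> simp only [Arc] at h <;> simp only [toNat] <;> omega

/-- The only paths of two arcs are `a i → c i → b j`. The second arc needs the label `some true` at
`(i, j)`; a closing arc needs `(i, j) = f`, labelled `some false`, or the label `none`. -/
lemma Arc.not_arc {L : Fin p × Fin r → Option Bool} {f : Fin p × Fin r} (hf : L f = some false)
    {u v w : Vertex p r q} (huv : Arc L f u v) (hvw : Arc L f v w) : ¬ Arc L f u w := by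
  intro huw
  cases u <;> cases v <;> simp only [Arc] at huv <;> cases w <;> simp only [Arc] at hvw huw
  subst huv
  rcases huw with h | h
  · rw [h, hf] at hvw; cases hvw
  · rw [h] at hvw; cases hvw

/-- Orient the edges of a triangle by `Arc`: six orientations are transitive and excluded by
`Arc.not_arc`; the two cyclic ones contradict monotonicity of `toNat`. -/
lemma cliqueFree_of_subset {L : Fin p × Fin r → Option Bool} {f : Fin p × Fin r}
    (hf : L f = some false) {E : Set (Sym2 (Vertex p r q))}
    (hE : E ⊆ insert (slotEdge f) (baseEdges L ∪ padEdges)) :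
    (SimpleGraph.fromEdgeSet E).CliqueFree 3 := by
  classical
  intro t ht
  rw [SimpleGraph.is3Clique_iff] at ht
  obtain ⟨x, y, z, hxy, hxz, hyz, -⟩ := ht
  have hadj : ∀ {v w}, (SimpleGraph.fromEdgeSet E).Adj v w → Arc L f v w ∨ Arc L f w v :=
    fun h => arc_or_arc_of_mem (hE ((SimpleGraph.fromEdgeSet_adj _).1 h).1)
  rcases hadj hxy with hxy | hxy <;> rcases hadj hyz with hyz | hyz <;>
    rcases hadj hxz with hxz | hxz
  · exact hxy.not_arc hf hyz hxz
  · have h1 := hxy.toNat_lt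
    have h2 := hyz.toNat_lt
    have h3 := hxz.toNat_lt
    omega
  · exact hxz.not_arc hf hyz hxy
  · exact hxz.not_arc hf hxy hyz
  · exact hxy.not_arc hf hxz hyz
  · exact hyz.not_arc hf hxz hxy
  · have h1 := hxy.toNat_lt
    have h2 := hyz.toNat_lt
    have h3 := hxz.toNat_lt
    omega
  · exact hyz.not_arc hf hxy hxz

lemma not_cliqueFree_of_subset {L : Fin p × Fin r → Option Bool} {f : Fin p × Fin r}
    (hf : L f = some true) {E : Set (Sym2 (Vertex p r q))}
    (hE : insert (slotEdge f) (baseEdges L) ⊆ E) :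
    ¬ (SimpleGraph.fromEdgeSet E).CliqueFree 3 := by
  classical
  intro h
  refine h {a f.1, c f.1, b f.2} (SimpleGraph.is3Clique_iff.2 ⟨_, _, _, ?_, ?_, ?_, rfl⟩)
  · exact (SimpleGraph.fromEdgeSet_adj _).2
      ⟨hE (Set.mem_insert_of_mem _ (Or.inl ⟨f.1, rfl⟩)), by simp⟩
  · exact (SimpleGraph.fromEdgeSet_adj _).2 ⟨hE (Set.mem_insert _ _), by simp⟩
  · exact (SimpleGraph.fromEdgeSet_adj _).2
      ⟨hE (Set.mem_insert_of_mem _ (Or.inr (Or.inr ⟨f, hf, rfl⟩))), by simp⟩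

end Vertex

open Vertex in
/-- Triangle-freeness of graphs with exactly `m` edges encodes the intersection problem. -/
theorem exists_encodesIntersection {p r q n m k : ℕ} (hn : 2 * p + r + 2 * q ≤ n) (hp : 0 < p)
    (hm : p + p * r + 1 ≤ m) (hq : m ≤ q * q) (j₀ : Fin k) :
    ∃ (c : (Fin p × Fin r → Option Bool) → SimpleGraph (Fin n))
      (e : (Fin p × Fin r → Bool) → SimpleGraph (Fin n)),
      EncodesIntersection c e j₀ {x : ∀ i, SiteGraph k n i | numEdges x = m} triangleFree := by
  classical
  -- The centre gets `m - 1` edges; the slot `f` of the intersection is the last one.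
  choose E hE₁ hE₂ hE₃ using fun L => exists_centerEdges (p := p) (r := r) (q := q) (M := m - 1)
    (by omega) (by omega) L
  let ψ : Vertex p r q ↪ Fin n := toFin hn
  have : Nonempty (Vertex p r q) := ⟨a ⟨0, hp⟩⟩
  refine ⟨fun L => (SimpleGraph.fromEdgeSet (E L)).map ψ,
    fun Y => (SimpleGraph.fromEdgeSet {s | ∃ g, Y g = true ∧ s = slotEdge g}).map ψ, ⟨?_⟩⟩
  intro i hi f y L Y hL hY hYL
  set x : ∀ i, SiteGraph k n i := encode (fun L => (SimpleGraph.fromEdgeSet (E L)).map ψ)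
    (fun Y => (SimpleGraph.fromEdgeSet {s | ∃ g, Y g = true ∧ s = slotEdge g}).map ψ) j₀ L Y
    with hx
  have hsub : insert (slotEdge f) (E L) ⊆ insert (slotEdge f) (baseEdges L ∪ padEdges) :=
    Set.insert_subset_insert (hE₂ L)
  have hU : unionGraph x = (SimpleGraph.fromEdgeSet (insert (slotEdge f) (E L))).map ψ := by
    apply le_antisymm
    · refine iSup_le fun j => ?_
      simp only [hx, encode]
      split_ifs with hj
      · exact SimpleGraph.map_monotone _ (SimpleGraph.fromEdgeSet_mono (Set.subset_insert _ _))
      · refine SimpleGraph.map_monotone _ (SimpleGraph.fromEdgeSet_mono ?_)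
        rintro _ ⟨g, hg, rfl⟩
        by_cases h : (j, g) = (i, f)
        · rw [(Prod.mk.inj h).2]
          exact Set.mem_insert _ _
        · exact Set.mem_insert_of_mem _ (hE₁ L (Or.inr (Or.inl ⟨g, hYL j g hj h hg, rfl⟩)))
    · intro v w hvw
      rw [SimpleGraph.map_adj] at hvw
      obtain ⟨v', w', hadj, rfl, rfl⟩ := hvw
      rw [SimpleGraph.fromEdgeSet_adj] at hadj
      obtain ⟨hmem | hmem, hne⟩ := hadj
      · refine (le_iSup x i) ?_
        simp only [hx, encode, if_neg hi]
        exact (SimpleGraph.map_adj _ _ _ _).2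
          ⟨v', w', (SimpleGraph.fromEdgeSet_adj _).2 ⟨⟨f, hY, hmem⟩, hne⟩, rfl, rfl⟩
      · refine (le_iSup x j₀) ?_
        simp only [hx, encode, if_true]
        exact (SimpleGraph.map_adj _ _ _ _).2
          ⟨v', w', (SimpleGraph.fromEdgeSet_adj _).2 ⟨hmem, hne⟩, rfl, rfl⟩
  constructor
  · change (unionGraph x).edgeSet.ncard = m
    rw [hU, SimpleGraph.edgeSet_map, Set.ncard_image_of_injective _ ψ.sym2Map.injective,
      SimpleGraph.edgeSet_fromEdgeSet]
    have hd : insert (slotEdge f) (E L) \ Sym2.diagSet = insert (slotEdge f) (E L) := by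
      rw [sdiff_eq_left, Set.disjoint_left]
      intro s hs hs'
      exact not_isDiag_of_mem (hsub hs) hs'
    have hf : slotEdge f ∉ E L := fun h => slotEdge_notMem (by simp [hL]) (hE₂ L h)
    rw [hd, Set.ncard_insert_of_notMem hf (Set.toFinite _), hE₃]
    omega
  · unfold triangleFree
    rw [hU]
    cases y with
    | true =>
      simp only [Bool.not_true, decide_eq_false_iff_not, SimpleGraph.cliqueFree_map_iff]
      exact not_cliqueFree_of_subset hL (Set.insert_subset_insert (hE₁ L))
    | false =>
      simp only [Bool.not_false, decide_eq_true_eq, SimpleGraph.cliqueFree_map_iff]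
      exact cliqueFree_of_subset hL hsub

/-! ### Parameters and conclusion -/

lemma le_randomizedCC {k : ℕ} {𝒢 : Type} {D : Set (Fin k → 𝒢)} {F : (Fin k → 𝒢) → Bool} {B : ℝ}
    (h : ∀ (P : Protocol k fun _ => 𝒢), P.Computes D F (1 / 3) → ∀ C : ℕ, P.cost D ≤ C → B ≤ C) :
    ENNReal.ofReal B ≤ ((randomizedCC (X := fun _ => 𝒢) (1 / 3) D F : ℕ∞) : ENNReal) := by
  have h1 : ((⌈B⌉₊ : ℕ) : ℕ∞) ≤ randomizedCC (X := fun _ => 𝒢) (1 / 3) D F := by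
    refine le_iInf₂ fun P hP => ?_
    cases hC : P.cost D with
    | top => exact le_top
    | coe C => exact_mod_cast Nat.ceil_le.2 (h P hP C hC.le)
  calc ENNReal.ofReal B ≤ ((⌈B⌉₊ : ℕ) : ENNReal) := by
        rw [← ENNReal.ofReal_natCast]
        exact ENNReal.ofReal_le_ofReal (Nat.le_ceil B)
    _ = (((⌈B⌉₊ : ℕ) : ℕ∞) : ENNReal) := by simp
    _ ≤ _ := by exact_mod_cast h1

lemma randomizedCC_mono {k : ℕ} {X : Fin k → Type} {δ : ℝ≥0∞} {D D' : Set (∀ i, X i)}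
    (h : D ⊆ D') (F : (∀ i, X i) → Bool) : randomizedCC δ D F ≤ randomizedCC δ D' F :=
  le_iInf₂ fun P hP => (iInf₂_le P fun x hx => hP x (h hx)).trans (biSup_mono fun _ hx => h hx)

/-- The bound that a gadget with many slots implies. -/
lemma mul_div_logb_le {k N C : ℕ} {κ m : ℝ} (hk : 2 ≤ k) (hN : κ * m ≤ N)
    (hN' : 20736 ≤ N) (h : ((k : ℝ) - 1) * N
      ≤ 3456 * (((k : ℝ) - 1) * Real.log 8 + 2 * C * Real.log (4 * (k : ℝ) ^ 2))) :
    κ / 110592 * (k * m / Real.logb 2 k) ≤ C := by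
  have hk' : (2 : ℝ) ≤ k := by exact_mod_cast hk
  have hN'' : (20736 : ℝ) ≤ N := by exact_mod_cast hN'
  have hl2 : 0 < Real.log 2 := Real.log_pos (by norm_num)
  have hl2' : Real.log 2 < 1 := by linarith [Real.log_two_lt_d9]
  have hlk : Real.log 2 ≤ Real.log k := Real.log_le_log (by norm_num) hk'
  have h8 : Real.log 8 ≤ 3 := by
    rw [show (8 : ℝ) = 2 ^ 3 by norm_num, Real.log_pow]
    push_cast
    linarith
  have h4 : Real.log (4 * (k : ℝ) ^ 2) ≤ 4 * Real.log k := by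
    rw [show (4 : ℝ) * (k : ℝ) ^ 2 = (2 * k) ^ 2 by ring, Real.log_pow,
      Real.log_mul (by norm_num) (by positivity)]
    push_cast
    linarith
  have hb : Real.log k ≤ Real.logb 2 k := by
    rw [Real.logb, le_div_iff₀ hl2]
    nlinarith
  have hb0 : 0 < Real.logb 2 k := by linarith
  have hC : (0 : ℝ) ≤ C := Nat.cast_nonneg _
  rw [← mul_div_assoc, div_le_iff₀ hb0]
  have e1 : ((k : ℝ) - 1) * Real.log 8 ≤ ((k : ℝ) - 1) * 3 :=
    mul_le_mul_of_nonneg_left h8 (by linarith)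
  have e2 : 2 * C * Real.log (4 * (k : ℝ) ^ 2) ≤ 2 * C * (4 * Real.logb 2 k) :=
    mul_le_mul_of_nonneg_left (by linarith) (by positivity)
  -- Since `20736 = 2 · 3 · 3456`, the `log 8` term is at most half of the left side. Then `110592 =
  -- 3456 · 8 · 2 · 2`: 8 from the code length, 2 from this halving, 2 from `k - 1 ≥ k / 2`.
  have e3 : ((k : ℝ) - 1) * 20736 ≤ ((k : ℝ) - 1) * N :=
    mul_le_mul_of_nonneg_left hN'' (by linarith)
  have e4 : (k : ℝ) / 2 * N ≤ ((k : ℝ) - 1) * N :=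
    mul_le_mul_of_nonneg_right (by linarith) (by linarith)
  have e5 : (k : ℝ) * (κ * m) ≤ k * N := mul_le_mul_of_nonneg_left hN (by linarith)
  nlinarith

/-- Gadget sizes: few vertices and edges, but a constant fraction of `m` slots. -/
lemma exists_sizes {γ : ℝ} (hγ0 : 0 < γ) (hγ : γ < 1 / 4) :
    ∃ n₀ : ℕ, ∃ κ : ℝ, 0 < κ ∧ ∀ n m : ℕ, n₀ ≤ n → n ≤ m → (m : ℝ) ≤ γ * (n : ℝ) ^ 2 →
      ∃ p r q : ℕ, 2 * p + r + 2 * q ≤ n ∧ 0 < p ∧ p + p * r + 1 ≤ m ∧ m ≤ q * q ∧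
        κ * m ≤ (p * r : ℕ) ∧ 20736 ≤ p * r := by
  have hs : √γ < 1 / 2 := by
    rw [Real.sqrt_lt' (by norm_num)]; norm_num; linarith
  have hs0 : 0 ≤ √γ := Real.sqrt_nonneg _
  -- The padding uses about `2 √γ n` vertices, leaving `2 η n` for the grid; this is where `γ < 1 /
  -- 4` is needed.
  set η := 1 / 2 - √γ with hη
  have hη0 : 0 < η := by linarith
  obtain ⟨t₀, ht₀⟩ := exists_nat_ge (2 / η)
  set t := t₀ + 8 with ht
  have htη : 2 ≤ η * t := by
    rw [div_le_iff₀ hη0] at ht₀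
    rw [ht]; push_cast; nlinarith
  have ht8 : (8 : ℝ) ≤ t := by rw [ht]; push_cast; linarith [(Nat.cast_nonneg t₀ : (0 : ℝ) ≤ t₀)]
  have ht0 : (0 : ℝ) < t := by linarith
  refine ⟨20736 * t, 1 / (2 * t ^ 2), by positivity, fun n m hn hnm hm => ?_⟩
  have hnR : (20736 : ℝ) * t ≤ n := by exact_mod_cast hn
  have hmR : (n : ℝ) ≤ m := by exact_mod_cast hnm
  have hn0 : (0 : ℝ) < n := by nlinarith
  have hm0 : (0 : ℝ) < m := by linarith
  have htn : 0 < t := by omega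
  have hnn : 0 < n := by exact_mod_cast hn0
  -- The grid has about `n / t` times `m / (t n)`, hence about `m / t ^ 2`, slots; the `+ 1` in `p`
  -- keeps it nonempty when `m < t n`.
  set r := n / t with hr
  set p := m / (t * n) + 1 with hp
  set q := ⌈√γ * n⌉₊ with hq
  have hr1 : (r : ℝ) ≤ n / t := Nat.cast_div_le
  have hr2 : (n : ℝ) / t < r + 1 := by
    rw [div_lt_iff₀ ht0]
    have := Nat.lt_div_mul_add (a := n) htn
    have h2 : n < (r + 1) * t := by rw [hr]; linarith
    exact_mod_cast h2
  have hr3 : 20736 ≤ r := (Nat.le_div_iff_mul_le htn).2 hn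
  have hp1 : (p : ℝ) ≤ m / (t * n) + 1 := by
    rw [hp]; push_cast
    have : ((m / (t * n) : ℕ) : ℝ) ≤ (m : ℝ) / ((t * n : ℕ) : ℝ) := Nat.cast_div_le
    push_cast at this
    linarith
  have hp2 : (m : ℝ) / (t * n) < p := by
    rw [div_lt_iff₀ (by positivity)]
    have := Nat.lt_div_mul_add (a := m) (b := t * n) (by positivity)
    have h2 : m < p * (t * n) := by rw [hp]; linarith
    exact_mod_cast h2
  have hq1 : √γ * n ≤ q := Nat.le_ceil _
  have hq2 : (q : ℝ) < √γ * n + 1 := Nat.ceil_lt_add_one (by positivity)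
  have hnt : (20736 : ℝ) ≤ n / t := (le_div_iff₀ ht0).2 hnR
  have hmn : (m : ℝ) / (t * n) ≤ n / t / 4 := by
    rw [div_le_iff₀ (by positivity)]
    have : (n : ℝ) / t / 4 * (t * n) = n ^ 2 / 4 := by field_simp
    rw [this]
    nlinarith
  have hηt : 2 * ((n : ℝ) / t) ≤ η * n := by
    rw [← mul_div_assoc, div_le_iff₀ ht0]
    nlinarith
  refine ⟨p, r, q, ?_, Nat.succ_pos _, ?_, ?_, ?_, ?_⟩
  · have h : (2 * p + r + 2 * q : ℝ) ≤ n := by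
      have : η * n + √γ * n = n / 2 := by rw [hη]; ring
      linarith
    exact_mod_cast h
  · have hmt : (m : ℝ) / (t * n) * (n / t) = m / t ^ 2 := by field_simp
    have h1 : (p : ℝ) * (r + 1) ≤ (m / (t * n) + 1) * (n / t + 1) :=
      mul_le_mul hp1 (by linarith) (by positivity) (by positivity)
    have h2 : (m : ℝ) / t ^ 2 ≤ m / 64 :=
      div_le_div_of_nonneg_left hm0.le (by norm_num) (by nlinarith)
    have h3 : (n : ℝ) / t ≤ m / 8 :=
      (div_le_div_of_nonneg_left hn0.le (by norm_num) ht8).trans (by linarith)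
    have h : (p + p * r + 1 : ℝ) ≤ m := by nlinarith
    exact_mod_cast h
  · have h : (m : ℝ) ≤ q * q := by
      have h1 : √γ * n * (√γ * n) ≤ q * q := mul_self_le_mul_self (by positivity) hq1
      have h2 : √γ * √γ = γ := Real.mul_self_sqrt hγ0.le
      nlinarith
    exact_mod_cast h
  · push_cast
    have h1 : (m : ℝ) / (t * n) * (n / t / 2) ≤ p * r :=
      mul_le_mul hp2.le (by linarith) (by positivity) (by positivity)
    calc (1 / (2 * (t : ℝ) ^ 2)) * m = (m : ℝ) / (t * n) * (n / t / 2) := by field_simp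
      _ ≤ _ := h1
  · exact hr3.trans (Nat.le_mul_of_pos_left _ (Nat.succ_pos _))

lemma exists_bound_eq {γ : ℝ} (hγ0 : 0 < γ) (hγ : γ < 1 / 4) :
    ∃ n₀ : ℕ, ∃ c : ℝ, 0 < c ∧ ∀ n m k : ℕ, n₀ ≤ n → n ≤ m → (m : ℝ) ≤ γ * (n : ℝ) ^ 2 →
      ENNReal.ofReal (c * (k * m / Real.logb 2 k)) ≤
        ((randomizedCC (k := k) (X := SiteGraph k n) (1 / 3) {x | numEdges x = m}
          triangleFree : ℕ∞) : ENNReal) := by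
  obtain ⟨n₀, κ, hκ, h⟩ := exists_sizes hγ0 hγ
  refine ⟨n₀, κ / 110592, by positivity, fun n m k hn hnm hm => ?_⟩
  -- For `k < 2` the logarithm is 0, and division by it gives the bound 0.
  rcases Nat.lt_or_ge k 2 with hk | hk
  · have : (k : ℝ) = 0 ∨ (k : ℝ) = 1 := by
      interval_cases k <;> simp
    rcases this with h0 | h0 <;> simp [h0]
  obtain ⟨p, r, q, h1, h2, h3, h4, h5, h6⟩ := h n m hn hnm hm
  obtain ⟨c, e, hE⟩ := exists_encodesIntersection h1 h2 h3 h4 (⟨0, by omega⟩ : Fin k)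
  refine le_randomizedCC fun P hP C hC => ?_
  have := sub_one_mul_card_le hP hC hE
  rw [Fintype.card_prod, Fintype.card_fin, Fintype.card_fin] at this
  exact mul_div_logb_le hk h5 h6 this

/-- The lower bound on `k` serves only to make `n` large, through `k ≤ n`. -/
lemma le_of_mul_logb_le {c : ℝ} (hc : 0 < c) {n k : ℕ} (hn : 2 ≤ n) (hkn : k ≤ n)
    (h : c * Real.logb 2 n ≤ k) : c ≤ n := by
  have h1 : 1 ≤ Real.logb 2 n := by
    rw [Real.le_logb_iff_rpow_le (by norm_num) (by positivity)]
    simpa using (by exact_mod_cast hn : (2 : ℝ) ≤ n)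
  have h2 : (k : ℝ) ≤ n := by exact_mod_cast hkn
  nlinarith

end MessagePassing

open MessagePassing in
theorem mainTheorem9 :
    (∀ γ : ℝ, 0 < γ → γ < 1 / 4 →
      ∃ cₖ : ℝ, 0 < cₖ ∧ ∃ c : ℝ, 0 < c ∧ ∀ n m k : ℕ,
        cₖ * Real.logb 2 n ≤ k → k ≤ min n m → n ≤ m → (m : ℝ) ≤ γ * (n : ℝ) ^ 2 →
        ENNReal.ofReal (c * (k * m / Real.logb 2 k)) ≤
          ((MessagePassing.randomizedCC (k := k) (X := MessagePassing.SiteGraph k n) (1 / 3)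
            {x | MessagePassing.numEdges x = m} MessagePassing.triangleFree : ℕ∞) : ENNReal)) ∧
    (∃ cₖ : ℝ, 0 < cₖ ∧ ∃ c : ℝ, 0 < c ∧ ∀ n m k : ℕ,
        cₖ * Real.logb 2 n ≤ k → k ≤ min n m → n ≤ m → m ≤ n.choose 2 →
        ENNReal.ofReal (c * (k * m / Real.logb 2 k)) ≤
          ((MessagePassing.randomizedCC (k := k) (X := MessagePassing.SiteGraph k n) (1 / 3)
            {x | MessagePassing.numEdges x ≤ m} MessagePassing.triangleFree : ℕ∞) : ENNReal)) := by
  constructor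
  · intro γ hγ0 hγ
    obtain ⟨n₀, c, hc, h⟩ := exists_bound_eq hγ0 hγ
    refine ⟨n₀ + 1, by positivity, c, hc, fun n m k hk hkn hnm hm => ?_⟩
    -- For `n = 1` the logarithm vanishes and does not force `n` to be large; the upper bound on `m`
    -- excludes this case.
    rcases Nat.lt_or_ge n 2 with hn | hn
    · have h0 : n = 0 := by
        by_contra h0
        have h1 : n = 1 := by omega
        subst h1
        have : (1 : ℝ) ≤ m := by exact_mod_cast hnm
        norm_num at hm
        linarith
      have : k = 0 := by omega
      simp [this]
    · refine h n m k ?_ hnm hm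
      have := le_of_mul_logb_le (by positivity) hn (hkn.trans (min_le_left _ _)) hk
      have h1 : n₀ + 1 ≤ n := by exact_mod_cast this
      omega
  · obtain ⟨n₀, c, hc, h⟩ := exists_bound_eq (γ := 1 / 8) (by norm_num) (by norm_num)
    refine ⟨n₀ + 8, by positivity, c / 8, by positivity, fun n m k hk hkn hnm hm => ?_⟩
    rcases Nat.lt_or_ge n 2 with hn | hn
    · have h0 : n = 0 := by
        by_contra h0
        have h1 : n = 1 := by omega
        subst h1
        simp at hm
        omega
      have : k = 0 := by omega
      simp [this]
    have h1 : n₀ + 8 ≤ n := by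
      exact_mod_cast le_of_mul_logb_le (by positivity) hn (hkn.trans (min_le_left _ _)) hk
    -- Within the range of the first part for `γ = 1 / 8`, and `m ≤ 8 m'` because `m ≤ n ^ 2 / 2`.
    -- The 8 in `n₀ + 8` ensures `n ≤ n ^ 2 / 8`.
    set m' := min m (n ^ 2 / 8) with hm'
    have hnm' : n ≤ m' := le_min hnm ((Nat.le_div_iff_mul_le (by norm_num)).2 (by nlinarith))
    have hm8 : (m' : ℝ) ≤ 1 / 8 * (n : ℝ) ^ 2 := by
      have h2 : m' * 8 ≤ n ^ 2 := (Nat.mul_le_mul_right 8 (min_le_right _ _)).trans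
        (Nat.div_mul_le_self _ _)
      have h3 : (m' : ℝ) * 8 ≤ (n : ℝ) ^ 2 := by exact_mod_cast h2
      linarith
    have hmm : m ≤ 8 * m' := by
      rcases min_choice m (n ^ 2 / 8) with h2 | h2
      · rw [hm', h2]; omega
      · rw [hm', h2]
        have h3 : m * 2 ≤ n ^ 2 := by
          rw [Nat.choose_two_right] at hm
          have h4 := Nat.div_mul_le_self (n * (n - 1)) 2
          have h5 : n * (n - 1) ≤ n ^ 2 := by
            rw [sq]; exact Nat.mul_le_mul_left _ (Nat.sub_le _ _)
          nlinarith
        have h6 : 64 ≤ n ^ 2 := by nlinarith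
        omega
    have hmmR : (m : ℝ) ≤ 8 * m' := by exact_mod_cast hmm
    have hlog : 0 ≤ Real.logb 2 k := by
      rcases Nat.eq_zero_or_pos k with h0 | h0
      · simp [h0]
      · exact Real.logb_nonneg (by norm_num) (by exact_mod_cast h0)
    refine le_trans (ENNReal.ofReal_le_ofReal ?_) ((h n m' k (by omega) hnm' hm8).trans ?_)
    · have h2 : (k : ℝ) * m / Real.logb 2 k ≤ k * (8 * m') / Real.logb 2 k :=
        div_le_div_of_nonneg_right (mul_le_mul_of_nonneg_left hmmR (Nat.cast_nonneg _)) hlog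
      calc c / 8 * (k * m / Real.logb 2 k) ≤ c / 8 * (k * (8 * m') / Real.logb 2 k) :=
            mul_le_mul_of_nonneg_left h2 (by positivity)
        _ = _ := by ring
    · have h2 := randomizedCC_mono (X := SiteGraph k n) (δ := 1 / 3)
        (D := {x | numEdges x = m'}) (D' := {x | numEdges x ≤ m})
        (fun x (hx : numEdges x = m') => hx.le.trans (min_le_left _ _)) triangleFree
      exact_mod_cast h2
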